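/- Let $k\ge 1$. **Conventions for (1).** Let $T_k$ be an equilateral triangle of side length $k$, subdivided into $k^2$ unit equilateral triangles: the \emph{upward} ones, parallel to $T_k$, and the \emph{downward} ones, opposite to $T_k$. A \emph{lozenge} is the union of an upward and a downward unit triangle that share an edge. A \emph{lozenge tiling} of $T_k$ is a decomposition of $T_k$ into lozenges and upward unit triangles (there are then exactly $k$ of the latter and $(k^2-k)/2$ lozenges). It is \emph{labeled} if its $k$ upward triangles are labeled bijectively by $1,\dots,k$. Let $d$ be a downward unit triangle and let $u\neq u'$ be two upward unit triangles that share an edge with $d$, so that $u\cup d\cup u'$ is a trapezoid. Two labeled lozenge tilings differ by a \emph{trapezoid flip} if, for some such $u,d,u'$, one of them contains the tiles $u$ and $u'\cup d$, the other contains the tiles $u'$ and $u\cup d$, all other tiles are the same, and the labels are the same, where the triangle that moves from $u$ to $u'$ keeps its label. **Conventions for (2).** Let $P$ be a polytope. A \emph{cell} of $P$ is a polytope of the same dimension as $P$ whose vertices are among the vertices of $P$. A \emph{polyhedral subdivision} of $P$ is a family of cells that cover $P$ and such that the intersection of any two of them is a (possibly empty) common face of both. A \emph{triangulation} is a polyhedral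 subdivision all of whose cells are simplices. A subdivision $S$ \emph{refines} $S'$ if every cell of $S$ is contained in a cell of $S'$. Two distinct triangulations of $P$ differ by a \emph{geometric bistellar flip} if there is a polyhedral subdivision of $P$ of which they are exactly the two proper refinements. $\Delta^{n}$ denotes the $n$-dimensional simplex. **Theorem.** 1. The graph whose vertices are all labeled lozenge tilings of $T_k$ and whose edges are the trapezoid flips is connected. 2. The graph whose vertices are all triangulations of $\Delta^2\times\Delta^{k-1}$ and whose edges are the geometric bistellar flips is connected. -/

import Mathlib

/-! ### Polyhedral subdivisions, triangulations and geometric bistellar flips -/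

section Subdivisions

variable {E : Type*} [NormedAddCommGroup E] [NormedSpace ℝ E]

/-- A cell of the polytope `P`: a subpolytope of the same dimension as `P` (equivalently, with the
same affine span) whose vertices are among the vertices of `P`. -/
def IsCell (P B : Set E) : Prop :=
  (∃ V ⊆ P.extremePoints ℝ, B = convexHull ℝ V) ∧ affineSpan ℝ B = affineSpan ℝ P

/-- A polyhedral subdivision of the polytope `P`: a family of cells that cover `P` and intersect
properly, i.e. the intersection of any two of them is a common (possibly empty) face of both. -/
structure IsPolyhedralSubdivision (P : Set E) (S : Set (Set E)) : Prop where
  isCell : ∀ B ∈ S, IsCell P B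
  cover : ⋃₀ S = P
  proper : ∀ B ∈ S, ∀ B' ∈ S, IsExposed ℝ B (B ∩ B') ∧ IsExposed ℝ B' (B ∩ B')

/-- The refinement relation `S ≤ S'` on families of cells. -/
def Refines (S S' : Set (Set E)) : Prop :=
  ∀ B ∈ S, ∃ B' ∈ S', B ⊆ B'

/-- A (geometric) simplex: the convex hull of an affinely independent set. -/
def IsSimplex (B : Set E) : Prop :=
  ∃ V : Set E, AffineIndependent ℝ ((↑) : V → E) ∧ B = convexHull ℝ V

/-- A triangulation of `P`: a polyhedral subdivision all of whose cells are simplices. -/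
def IsTriangulation (P : Set E) (T : Set (Set E)) : Prop :=
  IsPolyhedralSubdivision P T ∧ ∀ B ∈ T, IsSimplex B

/-- Two families `T ≠ T'` differ by a geometric bistellar flip if they are exactly the two
proper refinements of some polyhedral subdivision `S` of `P`. -/
def DifferByBistellarFlip (P : Set E) (T T' : Set (Set E)) : Prop :=
  T ≠ T' ∧ ∃ S : Set (Set E), IsPolyhedralSubdivision P S ∧
    ∀ R : Set (Set E),
      (IsPolyhedralSubdivision P R ∧ Refines R S ∧ R ≠ S) ↔ (R = T ∨ R = T')

/-- The graph of all triangulations of `P`, with an edge for every geometric bistellar flip. -/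
def bistellarFlipGraph (P : Set E) : SimpleGraph {T : Set (Set E) // IsTriangulation P T} where
  Adj T T' := DifferByBistellarFlip P T.1 T'.1
  symm := ⟨fun _ _ h => ⟨h.1.symm, by
    obtain ⟨S, hS, hR⟩ := h.2
    exact ⟨S, hS, fun R => (hR R).trans or_comm⟩⟩⟩
  loopless := ⟨fun _ h => h.1 rfl⟩

end Subdivisions

/-- The product `Δ² × Δ^(k-1)` of the standard simplices with `3` and with `k` vertices. -/
def triangleTimesSimplex (k : ℕ) : Set ((Fin 3 → ℝ) × (Fin k → ℝ)) :=
  stdSimplex ℝ (Fin 3) ×ˢ stdSimplex ℝ (Fin k)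

/-! ### Lozenge tilings and trapezoid flips

The lattice points of the triangle `T_k` are written in the affine coordinates in which its corners
are `(0, 0)`, `(k, 0)` and `(0, k)`; they are the `(x, y) : ℕ × ℕ` with `x + y ≤ k`. -/

/-- The unit triangles of the triangular grid. -/
inductive UnitTriangle : Type
  /-- the upward triangle with vertices `(i, j)`, `(i + 1, j)`, `(i, j + 1)` -/
  | up (i j : ℕ) : UnitTriangle
  /-- the downward triangle with vertices `(i + 1, j)`, `(i, j + 1)`, `(i + 1, j + 1)` -/
  | down (i j : ℕ) : UnitTriangle

namespace UnitTriangle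

/-- The three vertices of a unit triangle. -/
def vertices : UnitTriangle → Finset (ℕ × ℕ)
  | up i j => {(i, j), (i + 1, j), (i, j + 1)}
  | down i j => {(i + 1, j), (i, j + 1), (i + 1, j + 1)}

/-- The unit triangle lies in `T_k`. -/
def InSize (k : ℕ) (t : UnitTriangle) : Prop :=
  ∀ p ∈ t.vertices, p.1 + p.2 ≤ k

/-- The unit triangle is parallel to `T_k`. -/
def IsUpward (t : UnitTriangle) : Prop := ∃ i j, t = up i j

/-- The unit triangle is opposite to `T_k`. -/
def IsDownward (t : UnitTriangle) : Prop := ∃ i j, t = down i j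

/-- Two distinct unit triangles are adjacent if they share an edge, i.e. two vertices. -/
def Adjacent (t t' : UnitTriangle) : Prop :=
  (t.vertices ∩ t'.vertices).card = 2

end UnitTriangle

/-- A lozenge in `T_k` (as a set of unit triangles): the union of an upward and a downward unit
triangle of `T_k` that are adjacent. -/
def IsLozenge (k : ℕ) (B : Set UnitTriangle) : Prop :=
  ∃ u d : UnitTriangle, u.IsUpward ∧ d.IsDownward ∧ u.InSize k ∧ d.InSize k ∧
    u.Adjacent d ∧ B = {u, d}

/-- A tile that is a single upward unit triangle of `T_k`. -/
def IsUpwardTile (k : ℕ) (B : Set UnitTriangle) : Prop :=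
  ∃ u : UnitTriangle, u.IsUpward ∧ u.InSize k ∧ B = {u}

/-- A decomposition of `T_k` into lozenges and upward unit triangles. The number of upward
triangles is then necessarily `k`, and that of lozenges `(k ^ 2 - k) / 2`, because `T_k` has `k`
more upward than downward unit triangles. -/
structure IsLozengeTiling (k : ℕ) (S : Set (Set UnitTriangle)) : Prop where
  isTile : ∀ B ∈ S, IsLozenge k B ∨ IsUpwardTile k B
  partition : ∀ t : UnitTriangle, t.InSize k → ∃! B, B ∈ S ∧ t ∈ B

/-- A labeled lozenge tiling of `T_k`: a lozenge tiling together with a bijection `triangle` from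
the `k` labels to the upward unit triangles that are tiles. -/
@[ext]
structure LabeledLozengeTiling (k : ℕ) where
  tiles : Set (Set UnitTriangle)
  isTiling : IsLozengeTiling k tiles
  triangle : Fin k → UnitTriangle
  bijOn : Set.BijOn triangle Set.univ {t | {t} ∈ tiles}

/-- Two labeled lozenge tilings differ by a trapezoid flip. The trapezoid is the union of a downward
unit triangle `d` and of two of the upward unit triangles adjacent to it, `u` and `u'`. One of the
tilings splits it into the triangle `u` and the lozenge `{u', d}`, the other one into the triangle
`u'` and the lozenge `{u, d}`, and all their other tiles `R` are the same. The labels are the same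
too, where the triangle that moves from `u` to `u'` keeps its label `i`. -/
def DifferByTrapezoidFlip {k : ℕ} (L L' : LabeledLozengeTiling k) : Prop :=
  ∃ u d u' : UnitTriangle, u.IsUpward ∧ d.IsDownward ∧ u'.IsUpward ∧ u ≠ u' ∧
    u.Adjacent d ∧ u'.Adjacent d ∧
    (∃ R : Set (Set UnitTriangle),
      L.tiles = R ∪ {{u}, {u', d}} ∧ L'.tiles = R ∪ {{u'}, {u, d}}) ∧
    (∃ i : Fin k, L.triangle i = u ∧ L'.triangle i = u' ∧
      ∀ j, j ≠ i → L.triangle j = L'.triangle j)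

/-- The graph of all labeled lozenge tilings of `T_k`, with an edge for every trapezoid flip. -/
def trapezoidFlipGraph (k : ℕ) : SimpleGraph (LabeledLozengeTiling k) where
  Adj := DifferByTrapezoidFlip
  symm := ⟨by
    rintro L L' ⟨u, d, u', hu, hd, hu', hne, ha, ha', ⟨R, h1, h2⟩, i, hi, hi', hj⟩
    exact ⟨u', d, u, hu', hd, hu, hne.symm, ha', ha, ⟨R, h2, h1⟩, i, hi', hi,
      fun j h => (hj j h).symm⟩⟩
  loopless := ⟨by
    rintro L ⟨u, d, u', _, _, _, hne, _, _, _, i, hi, hi', _⟩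
    exact hne (hi.symm.trans hi')⟩

open Function Set

set_option linter.unusedSectionVars false

/-! ### Conical triangulations of a point configuration -/

section PointConfigurations

/-! Lozenge tilings. An upward tile above the bottom row can always be flipped down across the
downward triangle beneath it. Once all upward tiles are in the bottom row the lozenges are forced
(`LabeledLozengeTiling.eq_groundTiling`), and only a permutation of the labels remains. Three flips
around one downward triangle exchange two neighbouring labels (`reachable_swap`), and adjacent
transpositions generate the symmetric group.

Triangulations. The geometry is first made combinatorial. The vertices of the polytope lie on a
hyperplane that misses the origin, so a triangulation amounts to a complex on the vertex labels in
which every nonnegative combination has exactly one representation carried by a face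
(`IsConicalTriangulation`, `exists_eq_simplices`). A circuit with parts `A` and `N` of equal sum,
such that every face containing `N` can trade elements of `A`, gives another such complex, and the
two form a geometric bistellar flip (`IsFlippable.differByBistellarFlip`).

For the product of a triangle and a simplex the vertices form a grid with three rows and `k`
columns. Over an edge of the triangle the complex restricts to a triangulation of a prism, that is,
to a linear order of the labels (`edgeLT`). The key move (`exists_flips_swap`) interchanges two
labels that are adjacent along the edge from `c` to `a` and in the opposite order along the edge
from `c` to `b`. It is the flip of a square. The maximal faces that obstruct it are removed one at a
time by flips of hexagons, which leave all three orders unchanged; an obstruction that is extremal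
for a suitable potential always admits such a flip.

Thus the order from `c` to `a` can be sorted into the order from `c` to `b`, or into any order
between these two. Two such sorts make the orders at one vertex opposite to each other. Every order
lies between two opposite ones, so an edge there can be sorted at will, and two more sorts fix the
other edges. The resulting three orders force the staircase triangulation (`eq_staircase`), to which
every triangulation is therefore connected. -/

theorem indicator_one_nonneg {ι : Type*} (σ : Set ι) : (0 : ι → ℝ) ≤ σ.indicator 1 :=
  fun e => indicator_nonneg (fun _ _ => zero_le_one) e

theorem support_indicator_one {ι : Type*} (σ : Set ι) : support (σ.indicator (1 : ι → ℝ)) = σ := by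
  ext e; by_cases h : e ∈ σ <;> simp [h]

variable {ι E : Type*} [Fintype ι] [NormedAddCommGroup E] [NormedSpace ℝ E]

/-- The linear combination of the points of a configuration with given weights. -/
abbrev weightedSum (v : ι → E) : (ι → ℝ) →ₗ[ℝ] E := Fintype.linearCombination ℝ v

/-- A simplicial complex on the labels of a point configuration whose cones tile the cone of the
configuration: every nonnegative combination is uniquely supported on a face of the complex. -/
structure IsConicalTriangulation (v : ι → E) (K : Set (Set ι)) : Prop where
  down : ∀ σ ∈ K, ∀ ρ, ρ ⊆ σ → ρ ∈ K
  exists_rep : ∀ w : ι → ℝ, 0 ≤ w →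
    ∃ w' : ι → ℝ, 0 ≤ w' ∧ support w' ∈ K ∧ weightedSum v w' = weightedSum v w
  unique : ∀ w w' : ι → ℝ, 0 ≤ w → 0 ≤ w' → support w ∈ K → support w' ∈ K →
    weightedSum v w = weightedSum v w' → w = w'

theorem weightedSum_single [DecidableEq ι] (v : ι → E) (e : ι) :
    weightedSum v (Pi.single e 1) = v e := by
  simp

theorem apply_weightedSum (v : ι → E) (f : E →ₗ[ℝ] ℝ) (w : ι → ℝ) :
    f (weightedSum v w) = ∑ e, w e * f (v e) := by
  simp [Fintype.linearCombination_apply]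

namespace IsConicalTriangulation

variable {v : ι → E} {K : Set (Set ι)}

/-- Faces are linearly independent. -/
theorem eq_zero_of_weightedSum_eq_zero (hK : IsConicalTriangulation v K) {σ : Set ι} (hσ : σ ∈ K)
    {c : ι → ℝ} (hc : support c ⊆ σ) (h0 : weightedSum v c = 0) : c = 0 := by
  -- Both `|c|` and `|c| + c` are nonnegative, carried by `σ`, and have the same weighted sum, so
  -- uniqueness applies.
  have h1 : (fun e => |c e|) + c = fun e => |c e| := by
    apply hK.unique
    · intro e; simpa [add_comm] using (neg_le_iff_add_nonneg.1 (neg_abs_le (c e)))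
    · intro e; exact abs_nonneg _
    · refine hK.down σ hσ _ fun e he => hc fun h => he ?_
      simp [h]
    · refine hK.down σ hσ _ fun e he => hc fun h => he ?_
      simp [h]
    · rw [map_add, h0, add_zero]
  simpa using h1

theorem linearIndepOn (hK : IsConicalTriangulation v K) {σ : Set ι} (hσ : σ ∈ K) :
    LinearIndepOn ℝ v σ := by
  rw [linearIndepOn_iff]
  intro l hl h0
  have := hK.eq_zero_of_weightedSum_eq_zero hσ (c := l)
    (by rw [Finsupp.fun_support_eq]; exact (Finsupp.mem_supported ℝ l).1 hl)
    (by
      rwa [Finsupp.linearCombination_apply, Finsupp.sum_fintype _ _ (by simp),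
        ← Fintype.linearCombination_apply] at h0)
  exact DFunLike.coe_injective this

/-- A linear functional can be prescribed on a face. -/
theorem exists_functional (hK : IsConicalTriangulation v K) {σ : Set ι} (hσ : σ ∈ K)
    (g : ι → ℝ) : ∃ f : E →ₗ[ℝ] ℝ, ∀ e ∈ σ, f (v e) = g e := by
  have h := hK.linearIndepOn hσ
  obtain ⟨f, hf⟩ := LinearMap.exists_extend
    ((Module.Basis.span h.linearIndependent).constr ℝ fun e : σ => g e)
  refine ⟨f, fun e he => ?_⟩
  have := (Module.Basis.span h.linearIndependent).constr_basis ℝ (fun e : σ => g e) ⟨e, he⟩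
  rw [← this, ← hf, LinearMap.comp_apply, Module.Basis.span_apply]
  rfl

/-- If a point is pushed slightly off the relative interior of a face, in the direction of a point
of the cone, then it lies in the relative interior of a face that contains the first one. -/
theorem exists_rep_add_smul (hK : IsConicalTriangulation v K) {φ : E →ₗ[ℝ] ℝ}
    (hφ : ∀ e, φ (v e) = 1) {w u : ι → ℝ} (hw : 0 ≤ w) (hu : 0 ≤ u) (hσ : support w ∈ K) :
    ∃ ε : ℝ, 0 < ε ∧ ∃ w' : ι → ℝ, 0 ≤ w' ∧ support w' ∈ K ∧ support w ⊆ support w' ∧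
      weightedSum v w' = weightedSum v (w + ε • u) := by
  have hε : ∀ n : ℕ, (0 : ℝ) < 1 / ((n : ℝ) + 1) := fun n => Nat.one_div_pos_of_nat
  have hε1 : ∀ n : ℕ, 1 / ((n : ℝ) + 1) ≤ 1 := fun n => by
    rw [div_le_one (by positivity)]; linarith [(Nat.cast_nonneg n : (0 : ℝ) ≤ n)]
  -- Compactness: the functional `φ` bounds the representations of `w + u / (n + 1)`, so a
  -- subsequence converges to some `y`. A coordinate that is nonzero in the limit is nonzero
  -- eventually; hence `y` is carried by a face, and uniqueness gives `y = w`.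
  choose x hx0 hxK hx using fun n : ℕ => hK.exists_rep (w + (1 / ((n : ℝ) + 1)) • u)
    (add_nonneg hw (smul_nonneg (hε n).le hu))
  have hsum : ∀ n, ∑ e, x n e = ∑ e, w e + 1 / ((n : ℝ) + 1) * ∑ e, u e := fun n => by
    have := congrArg φ (hx n)
    simpa only [apply_weightedSum, hφ, mul_one, Pi.add_apply, Pi.smul_apply, smul_eq_mul,
      Finset.sum_add_distrib, ← Finset.mul_sum] using this
  have hmem : ∀ n, x n ∈ Icc (0 : ι → ℝ) (fun _ => ∑ e, w e + ∑ e, u e) := fun n => by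
    refine ⟨hx0 n, fun e => ?_⟩
    calc x n e ≤ ∑ e, x n e := Finset.single_le_sum (fun e _ => hx0 n e) (Finset.mem_univ e)
      _ ≤ _ := by
        rw [hsum n]
        have : 0 ≤ ∑ e, u e := Finset.sum_nonneg fun e _ => hu e
        nlinarith [hε1 n]
  obtain ⟨y, hy, ψ, hψ, hlim⟩ := (isCompact_Icc).tendsto_subseq hmem
  have hcont : Continuous (weightedSum v) := by
    simp only [weightedSum, Fintype.linearCombination, LinearMap.coe_mk, AddHom.coe_mk]
    fun_prop
  have hyw : weightedSum v y = weightedSum v w := by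
    refine tendsto_nhds_unique ((hcont.tendsto y).comp hlim) ?_
    have : Filter.Tendsto (fun n : ℕ => weightedSum v (w + (1 / ((n : ℝ) + 1)) • u)) Filter.atTop
        (nhds (weightedSum v (w + (0 : ℝ) • u))) :=
      (hcont.tendsto _).comp (tendsto_const_nhds.add
        ((tendsto_one_div_add_atTop_nhds_zero_nat (𝕜 := ℝ)).smul_const u))
    rw [zero_smul, add_zero] at this
    refine (this.comp hψ.tendsto_atTop).congr fun n => ?_
    simp only [comp_apply, hx]
  have hev : ∀ᶠ n in Filter.atTop, support y ⊆ support (x (ψ n)) := by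
    have : ∀ e ∈ support y, ∀ᶠ n in Filter.atTop, e ∈ support (x (ψ n)) := fun e he => by
      have h1 := (tendsto_pi_nhds.1 hlim e).eventually_ne he
      exact h1
    exact ((Set.toFinite (support y)).eventually_all).2 this
  obtain ⟨n, hn⟩ := hev.exists
  have hyK : support y ∈ K := hK.down _ (hxK _) _ hn
  obtain rfl := hK.unique y w hy.1 hw hyK hσ hyw
  exact ⟨_, hε (ψ n), x (ψ n), hx0 _, hxK _, hn, hx _⟩

/-- A maximal face spans. -/
theorem exists_support_subset (hK : IsConicalTriangulation v K) {φ : E →ₗ[ℝ] ℝ}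
    (hφ : ∀ e, φ (v e) = 1) {τ : Set ι} (hτ : Maximal (· ∈ K) τ) {u : ι → ℝ} (hu : 0 ≤ u) :
    ∃ c : ι → ℝ, support c ⊆ τ ∧ weightedSum v c = weightedSum v u := by
  -- Pushing the sum of the vertices of `τ` towards `u` ends in a face that contains `τ`, hence in
  -- `τ`. Solving for `u` gives the signed coefficients.
  obtain ⟨ε, hε, w', -, hwK, hsub, hM⟩ := hK.exists_rep_add_smul hφ
    (indicator_one_nonneg τ) hu (by rw [support_indicator_one]; exact hτ.prop)
  rw [support_indicator_one] at hsub
  have hle : support w' ⊆ τ := hτ.le_of_ge hwK hsub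
  refine ⟨ε⁻¹ • (w' - τ.indicator 1), ?_, ?_⟩
  · refine (support_const_smul_subset _ _).trans ((support_sub _ _).trans ?_)
    rw [support_indicator_one]
    exact union_subset hle le_rfl
  · rw [map_smul, map_sub, hM, map_add, add_sub_cancel_left, map_smul, smul_smul,
      inv_mul_cancel₀ hε.ne', one_smul]

/-- A spanning face is maximal. -/
theorem maximal_of_spanning (hK : IsConicalTriangulation v K) {τ : Set ι} (hτ : τ ∈ K)
    (h : ∀ e, v e ∈ Submodule.span ℝ (v '' τ)) : Maximal (· ∈ K) τ := by
  refine ⟨hτ, fun σ hσ hle e he => ?_⟩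
  by_contra hn
  -- A new vertex `e` of a larger face would be separated from `τ` by a functional, although `v e`
  -- lies in the span of `τ`.
  obtain ⟨f, hf⟩ := hK.exists_functional hσ (({e} : Set ι).indicator 1)
  have h0 : ∀ x ∈ Submodule.span ℝ (v '' τ), f x = 0 := by
    intro x hx
    refine Submodule.span_induction ?_ (map_zero f) ?_ ?_ hx
    · rintro _ ⟨e', he', rfl⟩
      rw [hf e' (hle he'), indicator_of_notMem]
      rintro rfl
      exact hn he'
    · intro x y _ _ hx hy; rw [map_add, hx, hy, add_zero]
    · intro a x _ hx; rw [map_smul, hx, smul_zero]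
  have := hf e he
  rw [h0 _ (h e)] at this
  simp at this

theorem mem_span_of_maximal (hK : IsConicalTriangulation v K) {φ : E →ₗ[ℝ] ℝ}
    (hφ : ∀ e, φ (v e) = 1) {τ : Set ι} (hτ : Maximal (· ∈ K) τ) (e : ι) :
    v e ∈ Submodule.span ℝ (v '' τ) := by
  classical
  obtain ⟨c, hc, hM⟩ := hK.exists_support_subset hφ hτ
    (u := Pi.single e 1) (by intro e'; by_cases h : e' = e <;> simp [h])
  rw [weightedSum_single] at hM
  rw [← hM, Fintype.linearCombination_apply]
  refine Submodule.sum_mem _ fun e' _ => ?_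
  by_cases h : c e' = 0
  · simp [h]
  · exact Submodule.smul_mem _ _ (Submodule.subset_span ⟨e', hc h, rfl⟩)

theorem exists_maximal (_ : IsConicalTriangulation v K) {σ : Set ι} (hσ : σ ∈ K) :
    ∃ τ, Maximal (· ∈ K) τ ∧ σ ⊆ τ := by
  obtain ⟨τ, h1, h2⟩ := (Set.toFinite K).exists_le_maximal hσ
  exact ⟨τ, h2, h1⟩

/-- A functional that vanishes on a maximal face vanishes. -/
theorem functional_eq_zero (hK : IsConicalTriangulation v K) {φ : E →ₗ[ℝ] ℝ}
    (hφ : ∀ e, φ (v e) = 1) {τ : Set ι} (hτ : Maximal (· ∈ K) τ) {f : E →ₗ[ℝ] ℝ}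
    (hf : ∀ e ∈ τ, f (v e) = 0) (e : ι) : f (v e) = 0 := by
  refine Submodule.span_induction ?_ (map_zero f) ?_ ?_ (hK.mem_span_of_maximal hφ hτ e)
  · rintro _ ⟨e', he', rfl⟩
    exact hf e' he'
  · intro x y _ _ hx hy; rw [map_add, hx, hy, add_zero]
  · intro a x _ hx; rw [map_smul, hx, smul_zero]

/-- Crossing the facet of a maximal face in the direction of a point of the configuration. -/
theorem exists_exchange (hK : IsConicalTriangulation v K) {φ : E →ₗ[ℝ] ℝ}
    (hφ : ∀ e, φ (v e) = 1) {τ : Set ι} (hτ : Maximal (· ∈ K) τ) {e p : ι}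
    {f : E →ₗ[ℝ] ℝ} (hf : ∀ e' ∈ τ \ {e}, f (v e') = 0) (hfp : f (v p) < 0) :
    ∃ e', f (v e') < 0 ∧ Maximal (· ∈ K) (insert e' (τ \ {e})) := by
  classical
  -- Push from the facet `τ \ {e}` towards `v p`. The face reached contains the facet, and `f` is
  -- negative at the point reached, so some vertex of that face is on the negative side.
  obtain ⟨ε, hε, w', hw', hwK, hsub, hM⟩ := hK.exists_rep_add_smul hφ
    (indicator_one_nonneg (τ \ {e})) (u := Pi.single p 1)
    (by intro e'; by_cases h : e' = p <;> simp [h])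
    (by rw [support_indicator_one]; exact hK.down _ hτ.prop _ sdiff_subset)
  rw [support_indicator_one] at hsub
  have hneg : ∑ e', w' e' * f (v e') < 0 := by
    rw [← apply_weightedSum, hM, map_add, map_add, map_smul, map_smul, weightedSum_single,
      apply_weightedSum, Finset.sum_eq_zero, zero_add]
    · exact mul_neg_of_pos_of_neg hε hfp
    · intro e' _
      by_cases h : e' ∈ τ \ {e}
      · rw [hf e' h, mul_zero]
      · rw [indicator_of_notMem h, zero_mul]
  obtain ⟨e', -, he'⟩ := Finset.exists_lt_of_sum_lt
    (hneg.trans_eq (Finset.sum_const_zero (s := (Finset.univ : Finset ι))).symm)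
  have hfe' : f (v e') < 0 := by
    by_contra h
    exact absurd he' (not_lt.2 (mul_nonneg (hw' e') (not_lt.1 h)))
  have hs' : e' ∈ support w' := by
    rw [mem_support]; intro h; rw [h, zero_mul] at he'; exact lt_irrefl _ he'
  refine ⟨e', hfe', hK.maximal_of_spanning (hK.down _ hwK _ (insert_subset hs' hsub)) ?_⟩
  obtain ⟨c, hc, hcM⟩ := hK.exists_support_subset hφ hτ
    (u := Pi.single e' 1) (by intro e''; by_cases h : e'' = e' <;> simp [h])
  rw [weightedSum_single] at hcM
  -- In the expansion of `v e'` over `τ` the coefficient of `e` is nonzero. So `v e` can be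
  -- recovered from `v e'` and the facet, and the new face still spans.
  have hce : f (v e') = c e * f (v e) := by
    rw [← hcM, apply_weightedSum, Finset.sum_eq_single e]
    · intro e'' _ hne
      by_cases h : e'' ∈ τ
      · rw [hf e'' ⟨h, hne⟩, mul_zero]
      · rw [notMem_support.1 (fun h' => h (hc h')), zero_mul]
    · simp
  have hc0 : c e ≠ 0 := by intro h; rw [hce, h, zero_mul] at hfe'; exact lt_irrefl _ hfe'
  set T := Submodule.span ℝ (v '' insert e' (τ \ {e})) with hT
  have hTm : ∀ x ∈ insert e' (τ \ {e}), v x ∈ T := fun x hx => Submodule.subset_span ⟨x, hx, rfl⟩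
  have heT : v e ∈ T := by
    have h1 : c e • v e = v e' - ∑ x ∈ Finset.univ.erase e, c x • v x := by
      rw [eq_sub_iff_add_eq, Finset.add_sum_erase _ (fun x => c x • v x) (Finset.mem_univ e), ← hcM,
        Fintype.linearCombination_apply]
    have h2 : c e • v e ∈ T := by
      rw [h1]
      refine Submodule.sub_mem _ (hTm _ (mem_insert _ _)) (Submodule.sum_mem _ fun x hx => ?_)
      by_cases h : c x = 0
      · simp [h]
      · exact Submodule.smul_mem _ _ (hTm _ (mem_insert_of_mem _ ⟨hc h, Finset.ne_of_mem_erase hx⟩))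
    simpa [smul_smul, inv_mul_cancel₀ hc0] using Submodule.smul_mem T (c e)⁻¹ h2
  intro x
  have hle : Submodule.span ℝ (v '' τ) ≤ T := by
    rw [Submodule.span_le]
    rintro _ ⟨y, hy, rfl⟩
    by_cases h : y = e
    · rw [h]; exact heT
    · exact hTm _ (mem_insert_of_mem _ ⟨hy, h⟩)
  exact hle (hK.mem_span_of_maximal hφ hτ x)

end IsConicalTriangulation

end PointConfigurations

/-! ### Conical triangulations versus geometric triangulations of a polytope -/

section PolytopeConfigurations

theorem sum_subtype_eq_sum {ι M : Type*} [Fintype ι] [AddCommMonoid M] {σ : Set ι} [Fintype σ]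
    (g : ι → M) (hg : ∀ e, g e ≠ 0 → e ∈ σ) : ∑ e : σ, g e = ∑ e, g e := by
  classical
  rw [← Finset.sum_filter_of_ne (p := (· ∈ σ)) fun e _ he => hg e he]
  exact (Finset.sum_subtype _ (by simp) g).symm

variable {ι E : Type*} [Fintype ι] [NormedAddCommGroup E] [NormedSpace ℝ E]

/-- The configuration `v` lists the vertices of the polytope `P`, and it lies on the hyperplane on
which the linear functional `φ` is one. -/
structure IsVertexConfiguration (P : Set E) (v : ι → E) (φ : E →ₗ[ℝ] ℝ) : Prop where
  height : ∀ e, φ (v e) = 1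
  hull : P = convexHull ℝ (range v)
  extreme : P.extremePoints ℝ = range v
  injective : Injective v

/-- The maximal simplices of a complex on the labels of a point configuration. -/
def simplices (v : ι → E) (K : Set (Set ι)) : Set (Set E) :=
  {B | ∃ τ, Maximal (· ∈ K) τ ∧ B = convexHull ℝ (v '' τ)}

theorem mem_convexHull_image_iff {v : ι → E} {σ : Set ι} {x : E} :
    x ∈ convexHull ℝ (v '' σ) ↔
      ∃ w : ι → ℝ, 0 ≤ w ∧ support w ⊆ σ ∧ ∑ e, w e = 1 ∧ weightedSum v w = x := by
  classical
  constructor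
  · revert x
    change convexHull ℝ (v '' σ) ⊆ {x | _}
    refine convexHull_min ?_ ?_
    · rintro _ ⟨e, he, rfl⟩
      refine ⟨Pi.single e 1, Pi.single_nonneg.2 zero_le_one, ?_, by simp, weightedSum_single v e⟩
      intro e' he'
      by_cases h : e' = e
      · rwa [h]
      · simp [h] at he'
    · rintro _ ⟨w, hw, hws, hw1, rfl⟩ _ ⟨w', hw', hws', hw1', rfl⟩ a b ha hb hab
      refine ⟨a • w + b • w', add_nonneg (smul_nonneg ha hw) (smul_nonneg hb hw'), ?_, ?_, ?_⟩
      · refine (support_add _ _).trans (union_subset ?_ ?_)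
        · exact (support_const_smul_subset _ _).trans hws
        · exact (support_const_smul_subset _ _).trans hws'
      · simp [Finset.sum_add_distrib, ← Finset.mul_sum, hw1, hw1', hab]
      · rw [map_add, map_smul, map_smul]
  · rintro ⟨w, hw, hws, hw1, rfl⟩
    rw [Fintype.linearCombination_apply,
      ← Finset.sum_filter_of_ne (p := (· ∈ σ)) (fun e _ he => hws fun h => he (by simp [h]))]
    refine (convex_convexHull ℝ _).sum_mem (fun e _ => hw e) ?_
      fun e he => subset_convexHull ℝ _ ⟨e, (Finset.mem_filter.1 he).2, rfl⟩
    rw [Finset.sum_filter_of_ne (p := (· ∈ σ)) (fun e _ he => hws he), hw1]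

theorem exists_uniform_weights {σ : Set ι} (hσ : σ.Nonempty) :
    ∃ a : ℝ, 0 < a ∧ ∑ e, (a • σ.indicator (1 : ι → ℝ)) e = 1 := by
  have h : 0 < ∑ e, σ.indicator (1 : ι → ℝ) e := by
    obtain ⟨e, he⟩ := hσ
    refine Finset.sum_pos' (fun e _ => indicator_one_nonneg σ e) ⟨e, Finset.mem_univ e, ?_⟩
    simp [he]
  refine ⟨_, inv_pos.2 h, ?_⟩
  simp only [Pi.smul_apply, smul_eq_mul, ← Finset.mul_sum]
  exact inv_mul_cancel₀ h.ne'

theorem support_smul_indicator_one {a : ℝ} (ha : 0 < a) (σ : Set ι) :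
    support (a • σ.indicator (1 : ι → ℝ)) = σ := by
  rw [support_const_smul_of_ne_zero _ _ ha.ne', support_indicator_one]

/-- An exposed face that contains a positive combination of points contains the points. -/
theorem mem_of_weightedSum_mem_exposed {v : ι → E} {B F : Set E} (hF : IsExposed ℝ B F)
    {w : ι → ℝ} (hw : 0 ≤ w) (hw1 : ∑ e, w e = 1) (hB : ∀ e ∈ support w, v e ∈ B)
    (hwF : weightedSum v w ∈ F) {e : ι} (he : e ∈ support w) : v e ∈ F := by
  obtain ⟨l, hl⟩ := hF ⟨_, hwF⟩
  rw [hl] at hwF ⊢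
  obtain ⟨-, hmax⟩ := hwF
  have h1 : ∑ e, w e * (l (weightedSum v w) - l (v e)) = 0 := by
    have := apply_weightedSum v (l : E →ₗ[ℝ] ℝ) w
    simp only [ContinuousLinearMap.coe_coe] at this
    simp only [mul_sub, Finset.sum_sub_distrib, ← Finset.sum_mul, hw1, one_mul]
    rw [this, sub_self]
  have h2 : ∀ e ∈ Finset.univ, 0 ≤ w e * (l (weightedSum v w) - l (v e)) := fun e _ => by
    by_cases h : w e = 0
    · rw [h, zero_mul]
    · exact mul_nonneg (hw e) (sub_nonneg.2 (hmax _ (hB e h)))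
  have h3 := (Finset.sum_eq_zero_iff_of_nonneg h2).1 h1 e (Finset.mem_univ e)
  have h4 : l (weightedSum v w) = l (v e) :=
    sub_eq_zero.1 ((mul_eq_zero.1 h3).resolve_left he)
  exact ⟨hB e he, fun y hy => h4 ▸ hmax y hy⟩

/-- The functional `f` itself exposes the face: it is nonpositive on the large hull, and a convex
combination of value zero puts no weight outside `ρ`. -/
theorem isExposed_convexHull_image [FiniteDimensional ℝ E] {v : ι → E} {ρ β : Set ι} (hρ : ρ ⊆ β)
    {f : E →ₗ[ℝ] ℝ} (h0 : ∀ e ∈ ρ, f (v e) = 0) (hneg : ∀ e ∈ β, e ∉ ρ → f (v e) < 0) :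
    IsExposed ℝ (convexHull ℝ (v '' β)) (convexHull ℝ (v '' ρ)) := by
  rintro ⟨x₀, hx₀⟩
  have hval : ∀ x ∈ convexHull ℝ (v '' ρ), f x = 0 := by
    intro x hx
    obtain ⟨w, -, hws, -, rfl⟩ := mem_convexHull_image_iff.1 hx
    rw [apply_weightedSum]
    refine Finset.sum_eq_zero fun e _ => ?_
    by_cases h : w e = 0
    · rw [h, zero_mul]
    · rw [h0 e (hws h), mul_zero]
  have hle : ∀ e ∈ β, f (v e) ≤ 0 := fun e he => by
    by_cases h : e ∈ ρ
    · exact (h0 e h).le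
    · exact (hneg e he h).le
  have hterm : ∀ w : ι → ℝ, 0 ≤ w → support w ⊆ β → ∀ e, w e * f (v e) ≤ 0 := by
    intro w hw hws e
    by_cases h : w e = 0
    · rw [h, zero_mul]
    · exact mul_nonpos_of_nonneg_of_nonpos (hw e) (hle e (hws h))
  refine ⟨LinearMap.toContinuousLinearMap f, ?_⟩
  simp only [LinearMap.coe_toContinuousLinearMap']
  ext x
  constructor
  · intro hx
    refine ⟨convexHull_mono (image_mono hρ) hx, fun y hy => ?_⟩
    obtain ⟨w, hw, hws, -, rfl⟩ := mem_convexHull_image_iff.1 hy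
    rw [hval x hx, apply_weightedSum]
    exact Finset.sum_nonpos fun e _ => hterm w hw hws e
  · rintro ⟨hx, hmax⟩
    obtain ⟨w, hw, hws, hw1, rfl⟩ := mem_convexHull_image_iff.1 hx
    have h1 := hmax x₀ (convexHull_mono (image_mono hρ) hx₀)
    rw [hval x₀ hx₀, apply_weightedSum] at h1
    have h2 := (Finset.sum_eq_zero_iff_of_nonpos fun e _ => hterm w hw hws e).1
      (le_antisymm (Finset.sum_nonpos fun e _ => hterm w hw hws e) h1)
    refine mem_convexHull_image_iff.2 ⟨w, hw, fun e he => ?_, hw1, rfl⟩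
    by_contra h
    rcases mul_eq_zero.1 (h2 e (Finset.mem_univ e)) with h3 | h3
    · exact he h3
    · exact (hneg e (hws he) h).ne h3

namespace IsVertexConfiguration

variable {P : Set E} {v : ι → E} {φ : E →ₗ[ℝ] ℝ}

theorem height_weightedSum (hv : IsVertexConfiguration P v φ) (w : ι → ℝ) :
    φ (weightedSum v w) = ∑ e, w e := by
  simp [apply_weightedSum, hv.height]

theorem convexHull_image_subset (hv : IsVertexConfiguration P v φ) (σ : Set ι) :
    convexHull ℝ (v '' σ) ⊆ P := by
  rw [hv.hull]; exact convexHull_mono (image_subset_range v σ)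

/-- A vertex of `P` remains extreme in every subpolytope that contains it, so it is one of the
generators. This lets cells be replaced by their sets of labels. -/
theorem mem_convexHull_image_iff_mem (hv : IsVertexConfiguration P v φ) {σ : Set ι} {e : ι} :
    v e ∈ convexHull ℝ (v '' σ) ↔ e ∈ σ := by
  refine ⟨fun h => ?_, fun h => subset_convexHull ℝ _ (mem_image_of_mem v h)⟩
  have h1 : v e ∈ (convexHull ℝ (v '' σ)).extremePoints ℝ :=
    inter_extremePoints_subset_extremePoints_of_subset (hv.convexHull_image_subset σ)
      ⟨h, hv.extreme ▸ mem_range_self e⟩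
  obtain ⟨e', he', h2⟩ := extremePoints_convexHull_subset h1
  exact hv.injective h2 ▸ he'

theorem preimage_convexHull_image (hv : IsVertexConfiguration P v φ) (σ : Set ι) :
    v ⁻¹' convexHull ℝ (v '' σ) = σ := by
  ext e; exact hv.mem_convexHull_image_iff_mem

theorem eq_convexHull_of_isCell (hv : IsVertexConfiguration P v φ) {B : Set E}
    (hB : IsCell P B) : B = convexHull ℝ (v '' (v ⁻¹' B)) := by
  obtain ⟨⟨V, hV, rfl⟩, -⟩ := hB
  rw [hv.extreme] at hV
  obtain ⟨σ, rfl⟩ := subset_range_iff_exists_image_eq.1 hV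
  rw [hv.preimage_convexHull_image]

theorem affineSpan_convexHull_image (hv : IsVertexConfiguration P v φ) {β : Set ι}
    (hβ : ∀ e, v e ∈ Submodule.span ℝ (v '' β)) :
    affineSpan ℝ (convexHull ℝ (v '' β)) = affineSpan ℝ P := by
  refine le_antisymm (affineSpan_mono ℝ (hv.convexHull_image_subset β)) ?_
  rw [hv.hull, affineSpan_convexHull, affineSpan_convexHull, affineSpan_le]
  rintro _ ⟨e, rfl⟩
  obtain ⟨e₀, he₀⟩ : β.Nonempty := by
    by_contra h
    rw [not_nonempty_iff_eq_empty] at h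
    have h1 := hβ e
    rw [h, image_empty, Submodule.span_empty, Submodule.mem_bot] at h1
    have h2 := hv.height e
    rw [h1, map_zero] at h2
    exact zero_ne_one h2
  have h0 : v e₀ ∈ affineSpan ℝ (v '' β) := subset_affineSpan ℝ _ ⟨e₀, he₀, rfl⟩
  -- The multiple of `v e₀` brings `x` back to height one, so that induction over the linear span
  -- proves a statement about the affine span.
  have key : ∀ x ∈ Submodule.span ℝ (v '' β), x + (1 - φ x) • v e₀ ∈ affineSpan ℝ (v '' β) := by
    intro x hx
    refine Submodule.span_induction ?_ ?_ ?_ ?_ hx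
    · rintro _ ⟨e', he', rfl⟩
      rw [hv.height, sub_self, zero_smul, add_zero]
      exact subset_affineSpan ℝ _ ⟨e', he', rfl⟩
    · simpa using h0
    · intro x y _ _ hx hy
      have := AffineSubspace.smul_vsub_vadd_mem _ (1 : ℝ) hx h0 hy
      convert this using 1
      simp only [vsub_eq_sub, vadd_eq_add, map_add, one_smul]
      module
    · intro a x _ hx
      have := AffineSubspace.smul_vsub_vadd_mem _ a hx h0 h0
      convert this using 1
      simp only [vsub_eq_sub, vadd_eq_add, map_smul, smul_eq_mul]
      module
  simpa [hv.height] using key _ (hβ e)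

theorem mem_span_of_isCell (hv : IsVertexConfiguration P v φ) {β : Set ι}
    (hβ : IsCell P (convexHull ℝ (v '' β))) (e : ι) : v e ∈ Submodule.span ℝ (v '' β) := by
  have h : v e ∈ affineSpan ℝ P := by
    rw [hv.hull, affineSpan_convexHull]
    exact subset_affineSpan ℝ _ (mem_range_self e)
  rw [← hβ.2, affineSpan_convexHull] at h
  exact affineSpan_subset_span h

theorem isCell_iff (hv : IsVertexConfiguration P v φ) {β : Set ι} :
    IsCell P (convexHull ℝ (v '' β)) ↔ ∀ e, v e ∈ Submodule.span ℝ (v '' β) := by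
  refine ⟨hv.mem_span_of_isCell, fun h => ⟨⟨v '' β, ?_, rfl⟩, hv.affineSpan_convexHull_image h⟩⟩
  rw [hv.extreme]; exact image_subset_range v β

theorem nonempty_of_isCell [Nonempty ι] (hv : IsVertexConfiguration P v φ) {β : Set ι}
    (hβ : IsCell P (convexHull ℝ (v '' β))) : β.Nonempty := by
  by_contra h
  rw [not_nonempty_iff_eq_empty] at h
  obtain ⟨e⟩ := ‹Nonempty ι›
  have h1 := hv.mem_span_of_isCell hβ e
  rw [h, image_empty, Submodule.span_empty, Submodule.mem_bot] at h1
  have h2 := hv.height e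
  rw [h1, map_zero] at h2
  exact zero_ne_one h2

/-- No polyhedral subdivision is a proper subfamily of another one. -/
theorem subdivision_eq_of_subset [Nonempty ι] (hv : IsVertexConfiguration P v φ)
    {R S : Set (Set E)} (hR : IsPolyhedralSubdivision P R) (hS : IsPolyhedralSubdivision P S)
    (h : R ⊆ S) : R = S := by
  refine h.antisymm fun B hB => ?_
  have hcell := hS.isCell B hB
  have hBe := hv.eq_convexHull_of_isCell hcell
  set ρ := v ⁻¹' B with hρ
  rw [hBe] at hcell
  -- The barycentre of the vertices of `B` lies in some cell `B'` of `R`, which also belongs to `S`.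
  -- The common face then contains all vertices of `B`, so `B` is a face of `B'`.
  obtain ⟨a, ha, ha1⟩ := exists_uniform_weights (hv.nonempty_of_isCell hcell)
  have hsupp := support_smul_indicator_one ha ρ
  have hnn : 0 ≤ a • ρ.indicator (1 : ι → ℝ) := smul_nonneg ha.le (indicator_one_nonneg ρ)
  have hx : weightedSum v (a • ρ.indicator 1) ∈ B := by
    rw [hBe]
    exact mem_convexHull_image_iff.2 ⟨_, hnn, hsupp.subset, ha1, rfl⟩
  have hxP : weightedSum v (a • ρ.indicator 1) ∈ P := by
    rw [← hS.cover]; exact ⟨B, hB, hx⟩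
  rw [← hR.cover] at hxP
  obtain ⟨B', hB', hx'⟩ := hxP
  obtain ⟨hF, hF'⟩ := hS.proper B hB B' (h hB')
  have hmem : ∀ e ∈ ρ, v e ∈ B ∩ B' := fun e he =>
    mem_of_weightedSum_mem_exposed hF hnn ha1 (fun e' he' => hsupp.subset he') ⟨hx, hx'⟩
      (hsupp.symm.subset he)
  have hsub : B ⊆ B' := by
    rw [hBe, hv.eq_convexHull_of_isCell (hR.isCell B' hB')]
    exact convexHull_mono (image_mono fun e he => (hmem e he).2)
  rw [inter_eq_left.2 hsub] at hF'
  obtain ⟨l, hl⟩ := hF' ⟨_, hx⟩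
  suffices B' ⊆ B by rwa [← this.antisymm hsub]
  rw [hv.eq_convexHull_of_isCell (hR.isCell B' hB'), hBe]
  refine convexHull_mono (image_mono fun e he => ?_)
  obtain ⟨e₀, he₀⟩ := hv.nonempty_of_isCell hcell
  -- The functional that exposes `B` in `B'` is constant on the vertices of `B`. These span, so it
  -- is constant on all vertices of `P`, and the exposed face is the whole of `B'`.
  have hconst : ∀ x ∈ Submodule.span ℝ (v '' ρ), l x = φ x * l (v e₀) := by
    intro x hx
    refine Submodule.span_induction ?_ (by simp) ?_ ?_ hx
    · rintro _ ⟨e', he', rfl⟩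
      have h1 := (hl.subset he').2 _ (hsub he₀)
      have h2 := (hl.subset he₀).2 _ (hsub he')
      rw [hv.height, one_mul]
      exact le_antisymm h2 h1
    · intro x y _ _ hx hy; rw [map_add, hx, hy, map_add, add_mul]
    · intro a x _ hx; rw [map_smul, hx, map_smul, smul_eq_mul, smul_eq_mul, mul_assoc]
  have h1 : l (v e) = l (v e₀) := by
    rw [hconst _ (hv.mem_span_of_isCell hcell e), hv.height, one_mul]
  change v e ∈ B
  rw [hl]
  exact ⟨he, fun y hy => h1 ▸ (hl.subset he₀).2 y hy⟩

/-- The maximal simplices of a conical triangulation form a triangulation. -/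
theorem isTriangulation_simplices [FiniteDimensional ℝ E] (hv : IsVertexConfiguration P v φ)
    {K : Set (Set ι)} (hK : IsConicalTriangulation v K) : IsTriangulation P (simplices v K) := by
  refine ⟨⟨?_, ?_, ?_⟩, ?_⟩
  · rintro _ ⟨τ, hτ, rfl⟩
    exact hv.isCell_iff.2 (hK.mem_span_of_maximal hv.height hτ)
  · apply subset_antisymm
    · rintro x ⟨_, ⟨τ, -, rfl⟩, hx⟩
      exact hv.convexHull_image_subset τ hx
    · intro x hx
      rw [hv.hull, ← image_univ] at hx
      obtain ⟨w, hw, -, hw1, rfl⟩ := mem_convexHull_image_iff.1 hx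
      obtain ⟨w', hw', hwK, hM⟩ := hK.exists_rep w hw
      obtain ⟨τ, hτ, hsub⟩ := hK.exists_maximal hwK
      refine ⟨_, ⟨τ, hτ, rfl⟩, mem_convexHull_image_iff.2 ⟨w', hw', hsub, ?_, hM⟩⟩
      rw [← hv.height_weightedSum, hM, hv.height_weightedSum, hw1]
  · have key : ∀ τ τ', τ ∈ K → τ' ∈ K →
        IsExposed ℝ (convexHull ℝ (v '' τ)) (convexHull ℝ (v '' τ) ∩ convexHull ℝ (v '' τ')) := by
      intro τ τ' hτ hτ'
      have h1 : convexHull ℝ (v '' τ) ∩ convexHull ℝ (v '' τ') = convexHull ℝ (v '' (τ ∩ τ')) := by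
        apply subset_antisymm
        · rintro x ⟨hx, hx'⟩
          obtain ⟨w, hw, hws, hw1, rfl⟩ := mem_convexHull_image_iff.1 hx
          obtain ⟨w', hw', hws', -, hM⟩ := mem_convexHull_image_iff.1 hx'
          obtain rfl := hK.unique w w' hw hw' (hK.down _ hτ _ hws) (hK.down _ hτ' _ hws') hM.symm
          exact mem_convexHull_image_iff.2 ⟨w, hw, subset_inter hws hws', hw1, rfl⟩
        · exact subset_inter (convexHull_mono (image_mono inter_subset_left))
            (convexHull_mono (image_mono inter_subset_right))
      rw [h1]
      obtain ⟨f, hf⟩ := hK.exists_functional hτ (-(τ ∩ τ')ᶜ.indicator 1)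
      refine isExposed_convexHull_image inter_subset_left (f := f) ?_ ?_
      · intro e he
        rw [hf e he.1]; simp [he.1, he.2]
      · intro e he hn
        rw [hf e he, Pi.neg_apply, indicator_of_mem (show e ∈ (τ ∩ τ')ᶜ from hn)]; simp
    rintro _ ⟨τ, hτ, rfl⟩ _ ⟨τ', hτ', rfl⟩
    refine ⟨key τ τ' hτ.prop hτ'.prop, ?_⟩
    rw [inter_comm]
    exact key τ' τ hτ'.prop hτ.prop
  · rintro _ ⟨τ, hτ, rfl⟩
    exact ⟨v '' τ, (hK.linearIndepOn hτ.prop).id_image.affineIndependent, rfl⟩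

/-- Every triangulation comes from a conical triangulation. -/
theorem exists_eq_simplices [Nonempty ι] (hv : IsVertexConfiguration P v φ)
    {T : Set (Set E)} (hT : IsTriangulation P T) :
    ∃ K, IsConicalTriangulation v K ∧ simplices v K = T := by
  obtain ⟨hS, hsimp⟩ := hT
  have hindep : ∀ B ∈ T, ∀ c : ι → ℝ, support c ⊆ v ⁻¹' B → weightedSum v c = 0 → c = 0 := by
    intro B hB c hc h0
    obtain ⟨V, hV, hBV⟩ := hsimp B hB
    have hsub : ∀ e ∈ v ⁻¹' B, v e ∈ V := by
      intro e he
      have h1 : v e ∈ B.extremePoints ℝ := by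
        refine inter_extremePoints_subset_extremePoints_of_subset (A := P) ?_
          ⟨he, hv.extreme ▸ mem_range_self e⟩
        rw [← hS.cover]; exact subset_sUnion_of_mem hB
      rw [hBV] at h1
      exact extremePoints_convexHull_subset h1
    have hA : AffineIndependent ℝ (fun e : v ⁻¹' B => v e) :=
      hV.comp_embedding ⟨fun e : v ⁻¹' B => (⟨v e, hsub e e.2⟩ : V), fun e e' h =>
        Subtype.ext (hv.injective (congrArg Subtype.val h))⟩
    have : Fintype (v ⁻¹' B) := Fintype.ofFinite _
    -- Since all points have height one, the coefficients of a linear relation sum to zero: it is an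
    -- affine relation.
    have := affineIndependent_iff.1 hA Finset.univ (fun e => c e)
      (by
        rw [sum_subtype_eq_sum c fun e h => hc h, ← hv.height_weightedSum, h0, map_zero])
      (by
        rw [sum_subtype_eq_sum (fun e => c e • v e) fun e h => hc fun h' => h (by simp [h']),
          ← Fintype.linearCombination_apply, h0])
    ext e
    by_cases h : e ∈ v ⁻¹' B
    · exact this ⟨e, h⟩ (Finset.mem_univ _)
    · exact notMem_support.1 fun h' => h (hc h')
  have hnorm : ∀ w : ι → ℝ, 0 ≤ w → w ≠ 0 → 0 < ∑ e, w e := by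
    intro w hw h0
    obtain ⟨e, he⟩ := ne_iff.1 h0
    exact Finset.sum_pos' (fun e _ => hw e) ⟨e, Finset.mem_univ e, (hw e).lt_of_ne' he⟩
  -- Scaled to height one, the common vector is a point of the face `B ∩ B'`, and a face that
  -- contains a point contains every vertex used in it with positive weight.
  have hsubface : ∀ B ∈ T, ∀ B' ∈ T, ∀ w w' : ι → ℝ, 0 ≤ w → 0 ≤ w' → support w ⊆ v ⁻¹' B →
      support w' ⊆ v ⁻¹' B' → weightedSum v w = weightedSum v w' → support w ⊆ v ⁻¹' B' := by
    intro B hB B' hB' w w' hw hw' hs hs' hM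
    by_cases h0 : w = 0
    · simp [h0]
    set t := ∑ e, w e with ht
    have htpos : 0 < t := hnorm w hw h0
    have hBe := hv.eq_convexHull_of_isCell (hS.isCell B hB)
    have hBe' := hv.eq_convexHull_of_isCell (hS.isCell B' hB')
    have h1 : ∑ e, (t⁻¹ • w) e = 1 := by
      simp only [Pi.smul_apply, smul_eq_mul, ← Finset.mul_sum]
      exact inv_mul_cancel₀ htpos.ne'
    have h1' : ∑ e, (t⁻¹ • w') e = 1 := by
      rw [← hv.height_weightedSum, map_smul, ← hM, ← map_smul, hv.height_weightedSum, h1]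
    have hn := smul_nonneg (inv_pos.2 htpos).le hw
    have hn' := smul_nonneg (inv_pos.2 htpos).le hw'
    have hmem : weightedSum v (t⁻¹ • w) ∈ B := by
      rw [hBe]
      exact mem_convexHull_image_iff.2
        ⟨_, hn, (support_const_smul_subset _ _).trans hs, h1, rfl⟩
    have hmem' : weightedSum v (t⁻¹ • w) ∈ B' := by
      rw [hBe', map_smul, hM, ← map_smul]
      exact mem_convexHull_image_iff.2
        ⟨_, hn', (support_const_smul_subset _ _).trans hs', h1', rfl⟩
    intro e he
    refine (mem_of_weightedSum_mem_exposed (hS.proper B hB B' hB').1 hn h1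
      (fun e' he' => hs (support_const_smul_subset _ _ he')) ⟨hmem, hmem'⟩ ?_).2
    rwa [support_const_smul_of_ne_zero _ _ (inv_pos.2 htpos).ne']
  have hK : IsConicalTriangulation v {σ | ∃ B ∈ T, σ ⊆ v ⁻¹' B} := by
    constructor
    · rintro σ ⟨B, hB, h⟩ ρ hρ
      exact ⟨B, hB, hρ.trans h⟩
    · intro w hw
      by_cases h0 : w = 0
      · obtain ⟨e⟩ := ‹Nonempty ι›
        have : v e ∈ ⋃₀ T := by
          rw [hS.cover, hv.hull]; exact subset_convexHull ℝ _ (mem_range_self e)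
        obtain ⟨B, hB, -⟩ := this
        exact ⟨w, hw, ⟨B, hB, by simp [h0]⟩, rfl⟩
      · set t := ∑ e, w e with ht
        have htpos : 0 < t := hnorm w hw h0
        have h1 : ∑ e, (t⁻¹ • w) e = 1 := by
          simp only [Pi.smul_apply, smul_eq_mul, ← Finset.mul_sum]
          exact inv_mul_cancel₀ htpos.ne'
        have hx : weightedSum v (t⁻¹ • w) ∈ ⋃₀ T := by
          rw [hS.cover, hv.hull, ← image_univ]
          exact mem_convexHull_image_iff.2
            ⟨_, smul_nonneg (inv_pos.2 htpos).le hw, subset_univ _, h1, rfl⟩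
        obtain ⟨B, hB, hxB⟩ := hx
        rw [hv.eq_convexHull_of_isCell (hS.isCell B hB)] at hxB
        obtain ⟨w', hw', hs', -, hM⟩ := mem_convexHull_image_iff.1 hxB
        refine ⟨t • w', smul_nonneg htpos.le hw',
          ⟨B, hB, (support_const_smul_subset _ _).trans hs'⟩, ?_⟩
        rw [map_smul, hM, map_smul, smul_smul, mul_inv_cancel₀ htpos.ne', one_smul]
    · rintro w w' hw hw' ⟨B, hB, hs⟩ ⟨B', hB', hs'⟩ hM
      have h := hsubface B hB B' hB' w w' hw hw' hs hs' hM
      refine sub_eq_zero.1 (hindep B' hB' _ ((support_sub _ _).trans (union_subset h hs')) ?_)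
      rw [map_sub, hM, sub_self]
  refine ⟨_, hK, ?_⟩
  have hmax : ∀ B ∈ T, Maximal (· ∈ {σ | ∃ B ∈ T, σ ⊆ v ⁻¹' B}) (v ⁻¹' B) := by
    intro B hB
    refine hK.maximal_of_spanning ⟨B, hB, le_rfl⟩ (hv.mem_span_of_isCell ?_)
    rw [← hv.eq_convexHull_of_isCell (hS.isCell B hB)]
    exact hS.isCell B hB
  ext B
  constructor
  · rintro ⟨τ, hτ, rfl⟩
    obtain ⟨B, hB, hsub⟩ := hτ.prop
    rw [hτ.eq_of_subset ⟨B, hB, le_rfl⟩ hsub, ← hv.eq_convexHull_of_isCell (hS.isCell B hB)]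
    exact hB
  · intro hB
    exact ⟨_, hmax B hB, hv.eq_convexHull_of_isCell (hS.isCell B hB)⟩

end IsVertexConfiguration

end PolytopeConfigurations

/-! ### Flips along circuits, and geometric bistellar flips -/

section Flips

variable {ι E : Type*} [Fintype ι] [NormedAddCommGroup E] [NormedSpace ℝ E]

/-- The circuit with positive part `A` and negative part `N` supports a flip of the complex `K`:
the face `N` has in `K` the same star as the boundary complex of `A` joined to the link of `N`. -/
structure IsFlippable (v : ι → E) (K : Set (Set ι)) (A N : Set ι) : Prop where
  disjoint : Disjoint A N
  nonempty_pos : A.Nonempty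
  nonempty_neg : N.Nonempty
  relation : weightedSum v (A.indicator 1) = weightedSum v (N.indicator 1)
  mem : N ∈ K
  link : ∀ σ ∈ K, N ⊆ σ → ∀ c ∈ A, (σ ∪ A) \ {c} ∈ K

/-- The complex obtained from `K` by the flip that removes the face `N` and inserts `A`. -/
def flipComplex (K : Set (Set ι)) (A N : Set ι) : Set (Set ι) :=
  {σ | ¬ N ⊆ σ ∧ (σ ∈ K ∨ (A ⊆ σ ∧ ∀ c ∈ A, (σ ∪ N) \ {c} ∈ K))}

/-- Weights can be shifted along a circuit until a weight on its negative part vanishes. -/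
theorem exists_shift {v : ι → E} {A N : Set ι} (hd : Disjoint A N) (hN : N.Nonempty)
    (hrel : weightedSum v (A.indicator 1) = weightedSum v (N.indicator 1))
    {w : ι → ℝ} (hw : 0 ≤ w) :
    ∃ n₀ ∈ N, 0 ≤ w + w n₀ • (A.indicator 1 - N.indicator 1) ∧
      n₀ ∉ support (w + w n₀ • (A.indicator 1 - N.indicator 1)) ∧
      support (w + w n₀ • (A.indicator 1 - N.indicator 1)) ⊆ support w ∪ A ∧
      (w n₀ ≠ 0 → N ⊆ support w ∧ A ⊆ support (w + w n₀ • (A.indicator 1 - N.indicator 1)) ∧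
        support w ⊆ support (w + w n₀ • (A.indicator 1 - N.indicator 1)) ∪ N) ∧
      weightedSum v (w + w n₀ • (A.indicator 1 - N.indicator 1)) = weightedSum v w := by
  -- The smallest weight on `N` is the largest shift that keeps all weights nonnegative.
  obtain ⟨n₀, hn₀, hmin⟩ := exists_min_image N w (toFinite N) hN
  have hval : ∀ e, (w + w n₀ • (A.indicator 1 - N.indicator 1) : ι → ℝ) e =
      w e + w n₀ * (A.indicator 1 e - N.indicator 1 e) := fun e => rfl
  have hA : ∀ e ∈ A, (w + w n₀ • (A.indicator 1 - N.indicator 1) : ι → ℝ) e = w e + w n₀ := fun e he => by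
    rw [hval, indicator_of_mem he, indicator_of_notMem (disjoint_left.1 hd he)]; simp
  have hN' : ∀ e ∈ N, (w + w n₀ • (A.indicator 1 - N.indicator 1) : ι → ℝ) e = w e - w n₀ := fun e he => by
    rw [hval, indicator_of_mem he, indicator_of_notMem (disjoint_right.1 hd he)]; simp; ring
  have ho : ∀ e, e ∉ A → e ∉ N → (w + w n₀ • (A.indicator 1 - N.indicator 1) : ι → ℝ) e = w e :=
    fun e h1 h2 => by rw [hval, indicator_of_notMem h1, indicator_of_notMem h2]; simp
  refine ⟨n₀, hn₀, ?_, ?_, ?_, ?_, ?_⟩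
  · intro e
    by_cases h1 : e ∈ A
    · rw [hA e h1]; exact add_nonneg (hw e) (hw n₀)
    · by_cases h2 : e ∈ N
      · rw [hN' e h2]; exact sub_nonneg.2 (hmin e h2)
      · rw [ho e h1 h2]; exact hw e
  · rw [notMem_support, hN' n₀ hn₀, sub_self]
  · intro e he
    by_cases h1 : e ∈ A
    · exact Or.inr h1
    · refine Or.inl fun h => he ?_
      by_cases h2 : e ∈ N
      · rw [hN' e h2, h]
        have := hmin e h2
        rw [h] at this
        rw [le_antisymm this (hw n₀)]; simp
      · rw [ho e h1 h2, h]
  · intro h0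
    have hpos : 0 < w n₀ := (hw n₀).lt_of_ne' h0
    refine ⟨fun e he => (hpos.trans_le (hmin e he)).ne', fun e he => ?_, fun e he => ?_⟩
    · rw [mem_support, hA e he]; exact (add_pos_of_nonneg_of_pos (hw e) hpos).ne'
    · by_cases h1 : e ∈ A
      · refine Or.inl ?_
        rw [mem_support, hA e h1]; exact (add_pos_of_nonneg_of_pos (hw e) hpos).ne'
      · by_cases h2 : e ∈ N
        · exact Or.inr h2
        · refine Or.inl ?_
          rw [mem_support, ho e h1 h2]; exact he
  · rw [map_add, map_smul, map_sub, hrel, sub_self, smul_zero, add_zero]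

namespace IsFlippable

variable {v : ι → E} {K : Set (Set ι)} {A N : Set ι}

theorem pos_notMem (h : IsFlippable v K A N) (hK : IsConicalTriangulation v K) : A ∉ K := by
  intro hA
  have h1 := hK.unique _ _ (indicator_one_nonneg A) (indicator_one_nonneg N)
    (by rwa [support_indicator_one]) (by rw [support_indicator_one]; exact h.mem) h.relation
  have h2 : A = N := by rw [← support_indicator_one A, h1, support_indicator_one]
  obtain ⟨a, ha⟩ := h.nonempty_pos
  exact disjoint_left.1 h.disjoint ha (h2 ▸ ha)

theorem not_pos_subset (h : IsFlippable v K A N) (hK : IsConicalTriangulation v K) {σ : Set ι}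
    (hσ : σ ∈ K) : ¬ A ⊆ σ := fun hA => h.pos_notMem hK (hK.down σ hσ A hA)

/-- Undoes the flip at the level of weights, so that uniqueness in the new complex can be deduced
from uniqueness in `K`. -/
theorem exists_shift_mem (h : IsFlippable v K A N) (hK : IsConicalTriangulation v K)
    {w : ι → ℝ} (hw : 0 ≤ w) (hwK : support w ∈ flipComplex K A N) :
    ∃ s : ℝ, 0 ≤ w + s • (N.indicator 1 - A.indicator 1) ∧
      support (w + s • (N.indicator 1 - A.indicator 1)) ∈ K := by
  obtain ⟨-, hK' | ⟨hA, hlink⟩⟩ := hwK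
  · exact ⟨0, by simpa using hw, by simpa using hK'⟩
  · obtain ⟨a, ha, h0, hsupp, hsub, -, -⟩ :=
      exists_shift h.disjoint.symm h.nonempty_pos h.relation.symm hw
    refine ⟨_, h0, hK.down _ (hlink a ha) _ fun e he => ⟨hsub he, ?_⟩⟩
    rintro rfl
    exact hsupp he

/-- Representations in the two complexes differ by a shift along the circuit. Shifting until a
weight on `N` vanishes gives existence; shifting back into `K` gives uniqueness. -/
theorem isConicalTriangulation_flipComplex (h : IsFlippable v K A N)
    (hK : IsConicalTriangulation v K) : IsConicalTriangulation v (flipComplex K A N) := by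
  constructor
  · rintro σ ⟨hN, hσ⟩ ρ hρ
    refine ⟨fun h' => hN (h'.trans hρ), ?_⟩
    obtain hσ | ⟨-, hlink⟩ := hσ
    · exact Or.inl (hK.down σ hσ ρ hρ)
    · by_cases hAρ : A ⊆ ρ
      · exact Or.inr ⟨hAρ, fun c hc => hK.down _ (hlink c hc) _
          (sdiff_subset_sdiff_left (union_subset_union_left N hρ))⟩
      · obtain ⟨c, hc, hcρ⟩ := not_subset.1 hAρ
        refine Or.inl (hK.down _ (hlink c hc) _ fun e he => ⟨Or.inl (hρ he), ?_⟩)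
        rintro rfl
        exact hcρ he
  · intro w hw
    obtain ⟨u, hu, huK, hM⟩ := hK.exists_rep w hw
    obtain ⟨n, hn, h0, hsupp, hsub, hpos, hM'⟩ :=
      exists_shift h.disjoint h.nonempty_neg h.relation hu
    refine ⟨_, h0, ⟨fun h' => hsupp (h' hn), ?_⟩, hM'.trans hM⟩
    by_cases hun : u n = 0
    · left; rw [hun]; simpa using huK
    · right
      obtain ⟨hNu, hAu, -⟩ := hpos hun
      refine ⟨hAu, fun c hc => hK.down _ (h.link _ huK hNu c hc) _
        (sdiff_subset_sdiff_left (union_subset hsub ?_))⟩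
      exact hNu.trans subset_union_left
  · intro w w' hw hw' hwK hwK' hM
    obtain ⟨s, hs, hsK⟩ := h.exists_shift_mem hK hw hwK
    obtain ⟨s', hs', hsK'⟩ := h.exists_shift_mem hK hw' hwK'
    have heq := hK.unique _ _ hs hs' hsK hsK' (by
      rw [map_add, map_add, map_smul, map_smul, map_sub, h.relation, sub_self, smul_zero,
        smul_zero, hM])
    have hval : ∀ e ∈ N, w e + s = w' e + s' := fun e he => by
      have := congrFun heq e
      simpa [indicator_of_mem he, indicator_of_notMem (disjoint_right.1 h.disjoint he)] using this
    -- If the two shifts differed, one of `w`, `w'` would be positive on all of `N`, which no face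
    -- of the new complex allows.
    have hss : s = s' := by
      rcases lt_trichotomy s s' with hlt | heq | hlt
      · refine absurd (fun e he => ?_) hwK.1
        have := hval e he
        exact ne_of_gt (by linarith [show 0 ≤ w' e from hw' e])
      · exact heq
      · refine absurd (fun e he => ?_) hwK'.1
        have := hval e he
        exact ne_of_gt (by linarith [show 0 ≤ w e from hw e])
    rw [hss] at heq
    exact add_right_cancel heq

/-- The cells, as sets of labels, of the common coarsening of the two sides of a flip. -/
def IsFlipCell (K : Set (Set ι)) (A N β : Set ι) : Prop :=
  (Maximal (· ∈ K) β ∧ ¬ N ⊆ β) ∨ ∃ τ, Maximal (· ∈ K) τ ∧ N ⊆ τ ∧ β = τ ∪ A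

theorem pos_subset_iff_neg_subset (h : IsFlippable v K A N) (hK : IsConicalTriangulation v K)
    {β : Set ι} (hβ : IsFlipCell K A N β) : A ⊆ β ↔ N ⊆ β := by
  obtain ⟨h1, h2⟩ | ⟨τ, -, h2, rfl⟩ := hβ
  · exact iff_of_false (h.not_pos_subset hK h1.prop) h2
  · exact iff_of_true subset_union_right (h2.trans subset_union_left)

theorem span_of_isFlipCell {φ : E →ₗ[ℝ] ℝ} (hφ : ∀ e, φ (v e) = 1)
    (hK : IsConicalTriangulation v K) {β : Set ι} (hβ : IsFlipCell K A N β) (e : ι) :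
    v e ∈ Submodule.span ℝ (v '' β) := by
  obtain ⟨h1, -⟩ | ⟨τ, h1, -, rfl⟩ := hβ
  · exact hK.mem_span_of_maximal hφ h1 e
  · exact Submodule.span_mono (image_mono subset_union_left) (hK.mem_span_of_maximal hφ h1 e)

theorem exists_rep_of_isFlipCell (h : IsFlippable v K A N) (hK : IsConicalTriangulation v K)
    {β : Set ι} (hβ : IsFlipCell K A N β) {w : ι → ℝ} (hw : 0 ≤ w) (hws : support w ⊆ β) :
    ∃ w', 0 ≤ w' ∧ support w' ⊆ β ∧ support w' ∈ K ∧ weightedSum v w' = weightedSum v w := by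
  obtain ⟨h1, -⟩ | ⟨τ, h1, h2, rfl⟩ := hβ
  · exact ⟨w, hw, hws, hK.down _ h1.prop _ hws, rfl⟩
  · obtain ⟨a, ha, h0, hsupp, hsub, -, hM⟩ :=
      exists_shift h.disjoint.symm h.nonempty_pos h.relation.symm hw
    have hsub' := hsub.trans (union_subset hws (h2.trans subset_union_left))
    refine ⟨_, h0, hsub', hK.down _ (h.link _ h1.prop h2 a ha) _ fun e he => ⟨hsub' he, ?_⟩, hM⟩
    rintro rfl
    exact hsupp he

/-- The circuit is the only linear relation on a joined cell `τ ∪ A`. Values can be prescribed on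
the face left after deleting some `c` in `A`, and `hg` forces the value at `c`. -/
theorem exists_functional_of_isFlipCell (h : IsFlippable v K A N)
    (hK : IsConicalTriangulation v K) {β : Set ι} (hβ : IsFlipCell K A N β) (g : ι → ℝ)
    (hg : ∑ e, A.indicator 1 e * g e = ∑ e, N.indicator 1 e * g e) :
    ∃ f : E →ₗ[ℝ] ℝ, ∀ e ∈ β, f (v e) = g e := by
  obtain ⟨h1, -⟩ | ⟨τ, h1, h2, rfl⟩ := hβ
  · exact hK.exists_functional h1.prop g
  · obtain ⟨c, hc⟩ := h.nonempty_pos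
    obtain ⟨f, hf⟩ := hK.exists_functional (h.link _ h1.prop h2 c hc) g
    have hrel := congrArg f h.relation
    rw [apply_weightedSum, apply_weightedSum] at hrel
    have hN : ∑ e, N.indicator 1 e * f (v e) = ∑ e, N.indicator 1 e * g e := by
      refine Finset.sum_congr rfl fun e _ => ?_
      by_cases he : e ∈ N
      · rw [hf e ⟨Or.inl (h2 he), ?_⟩]
        rintro rfl
        exact disjoint_left.1 h.disjoint hc he
      · rw [indicator_of_notMem he, zero_mul, zero_mul]
    have hzero : ∑ e, A.indicator 1 e * (f (v e) - g e) = 0 := by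
      simp only [mul_sub, Finset.sum_sub_distrib]
      rw [hrel, hN, hg, sub_self]
    rw [Finset.sum_eq_single c, indicator_of_mem hc, Pi.one_apply, one_mul] at hzero
    · refine ⟨f, fun e he => ?_⟩
      by_cases hec : e = c
      · rw [hec]; exact sub_eq_zero.1 hzero
      · exact hf e ⟨he, hec⟩
    · intro e _ hec
      by_cases he : e ∈ A
      · rw [hf e ⟨Or.inr he, hec⟩, sub_self, mul_zero]
      · rw [indicator_of_notMem he, zero_mul]
    · simp

variable {P : Set E} {φ : E →ₗ[ℝ] ℝ}

theorem isPolyhedralSubdivision [FiniteDimensional ℝ E] (hv : IsVertexConfiguration P v φ)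
    (h : IsFlippable v K A N) (hK : IsConicalTriangulation v K) :
    IsPolyhedralSubdivision P {B | ∃ β, IsFlipCell K A N β ∧ B = convexHull ℝ (v '' β)} := by
  refine ⟨?_, ?_, ?_⟩
  · rintro _ ⟨β, hβ, rfl⟩
    exact hv.isCell_iff.2 (span_of_isFlipCell hv.height hK hβ)
  · apply subset_antisymm
    · rintro x ⟨_, ⟨τ, -, rfl⟩, hx⟩
      exact hv.convexHull_image_subset τ hx
    · rw [← (hv.isTriangulation_simplices hK).1.cover]
      rintro x ⟨_, ⟨τ, hτ, rfl⟩, hx⟩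
      by_cases hN : N ⊆ τ
      · exact ⟨_, ⟨τ ∪ A, Or.inr ⟨τ, hτ, hN, rfl⟩, rfl⟩,
          convexHull_mono (image_mono subset_union_left) hx⟩
      · exact ⟨_, ⟨τ, Or.inl ⟨hτ, hN⟩, rfl⟩, hx⟩
  · have key : ∀ β β', IsFlipCell K A N β → IsFlipCell K A N β' →
        IsExposed ℝ (convexHull ℝ (v '' β)) (convexHull ℝ (v '' β) ∩ convexHull ℝ (v '' β')) := by
      intro β β' hβ hβ'
      have h1 : convexHull ℝ (v '' β) ∩ convexHull ℝ (v '' β') = convexHull ℝ (v '' (β ∩ β')) := by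
        apply subset_antisymm
        · rintro x ⟨hx, hx'⟩
          obtain ⟨w, hw, hws, hw1, rfl⟩ := mem_convexHull_image_iff.1 hx
          obtain ⟨w', hw', hws', -, hM⟩ := mem_convexHull_image_iff.1 hx'
          -- Within each of the two cells the point has a representation carried by `K`. These
          -- coincide, so they are carried by `β ∩ β'`.
          obtain ⟨u, hu, hus, huK, hMu⟩ := h.exists_rep_of_isFlipCell hK hβ hw hws
          obtain ⟨u', hu', hus', huK', hMu'⟩ := h.exists_rep_of_isFlipCell hK hβ' hw' hws'
          obtain rfl := hK.unique u u' hu hu' huK huK' (hMu.trans (hM.symm.trans hMu'.symm))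
          refine mem_convexHull_image_iff.2 ⟨u, hu, subset_inter hus hus', ?_, hMu⟩
          rw [← hv.height_weightedSum, hMu, hv.height_weightedSum, hw1]
        · exact subset_inter (convexHull_mono (image_mono inter_subset_left))
            (convexHull_mono (image_mono inter_subset_right))
      rw [h1]
      set a : ℝ := ∑ e, A.indicator 1 e * β'ᶜ.indicator 1 e with ha
      set n : ℝ := ∑ e, N.indicator 1 e * β'ᶜ.indicator 1 e with hn
      have hnn : ∀ (M : Set ι) e, 0 ≤ M.indicator (1 : ι → ℝ) e * β'ᶜ.indicator 1 e :=
        fun M e => mul_nonneg (indicator_one_nonneg M e) (indicator_one_nonneg _ e)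
      have hpos : ∀ M : Set ι, ¬ M ⊆ β' → 0 < ∑ e, M.indicator 1 e * β'ᶜ.indicator (1 : ι → ℝ) e := by
        intro M hM
        obtain ⟨e, he, he'⟩ := not_subset.1 hM
        refine Finset.sum_pos' (fun e _ => hnn M e) ⟨e, Finset.mem_univ e, ?_⟩
        rw [indicator_of_mem he, indicator_of_mem (show e ∈ β'ᶜ from he')]; simp
      -- The values vanish on `β'` and are to be negative off it. Here `a` and `n` count the
      -- elements of `A` and `N` outside `β'`; the crossed factors make both sums over the circuit
      -- equal to `-a * n`. Since `A ⊆ β'` iff `N ⊆ β'`, the factor is positive wherever it is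
      -- needed.
      let g : ι → ℝ := fun e => -(β'ᶜ.indicator 1 e *
        (n * A.indicator 1 e + a * N.indicator 1 e + (A ∪ N)ᶜ.indicator 1 e))
      have hgA : ∀ e, A.indicator 1 e * g e = -n * (A.indicator 1 e * β'ᶜ.indicator 1 e) := by
        intro e
        by_cases he : e ∈ A
        · simp [g, he, disjoint_left.1 h.disjoint he, mul_comm]
        · simp [he]
      have hgN : ∀ e, N.indicator 1 e * g e = -a * (N.indicator 1 e * β'ᶜ.indicator 1 e) := by
        intro e
        by_cases he : e ∈ N
        · simp [g, he, disjoint_right.1 h.disjoint he, mul_comm]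
        · simp [he]
      obtain ⟨f, hf⟩ := h.exists_functional_of_isFlipCell hK hβ g (by
        simp only [hgA, hgN, ← Finset.mul_sum, ← ha, ← hn]
        ring)
      refine isExposed_convexHull_image inter_subset_left (f := f) ?_ ?_
      · intro e he
        rw [hf e he.1]
        simp [g, he.2]
      · intro e he hne
        have heβ' : e ∉ β' := fun h' => hne ⟨he, h'⟩
        have hiff := h.pos_subset_iff_neg_subset hK hβ'
        rw [hf e he]
        by_cases h1 : e ∈ A
        · have : 0 < n := hpos N fun h' => heβ' (hiff.2 h' h1)
          simpa [g, h1, heβ', disjoint_left.1 h.disjoint h1] using this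
        · by_cases h2 : e ∈ N
          · have : 0 < a := hpos A fun h' => heβ' (hiff.1 h' h2)
            simpa [g, h1, h2, heβ'] using this
          · simp [g, h1, h2, heβ']
    rintro _ ⟨β, hβ, rfl⟩ _ ⟨β', hβ', rfl⟩
    refine ⟨key β β' hβ hβ', ?_⟩
    rw [inter_comm]
    exact key β' β hβ' hβ

/-- A cell whose vertices are vertices of a cell of the common coarsening is a cell of the
coarsening or of one of the two sides of the flip. -/
theorem classification (hv : IsVertexConfiguration P v φ) (h : IsFlippable v K A N)
    (hK : IsConicalTriangulation v K) {ρ β : Set ι} (hρ : IsCell P (convexHull ℝ (v '' ρ)))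
    (hβ : IsFlipCell K A N β) (hρβ : ρ ⊆ β) :
    (A ⊆ ρ ∧ N ⊆ ρ ∧ IsFlipCell K A N ρ) ∨ (¬ A ⊆ ρ ∧ Maximal (· ∈ K) ρ) ∨
      (A ⊆ ρ ∧ ¬ N ⊆ ρ ∧ Maximal (· ∈ flipComplex K A N) ρ) := by
  have hspan := hv.mem_span_of_isCell hρ
  have hKmax : ρ ∈ K → ¬ A ⊆ ρ ∧ Maximal (· ∈ K) ρ := fun hρK =>
    ⟨h.not_pos_subset hK hρK, hK.maximal_of_spanning hρK hspan⟩
  have hβ₀ := hβ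
  obtain ⟨h1, -⟩ | ⟨τ, h1, h2, rfl⟩ := hβ
  · exact Or.inr (Or.inl (hKmax (hK.down _ h1.prop _ hρβ)))
  by_cases hA : A ⊆ ρ
  · by_cases hN : N ⊆ ρ
    · refine Or.inl ⟨hA, hN, ?_⟩
      -- Suppose that `ρ` contains the circuit and misses `e`. Then the functional that is one at
      -- `e` and zero on the rest of the cell respects the circuit relation and vanishes on `ρ`,
      -- which spans.
      suffices ρ = τ ∪ A by rwa [this]
      refine hρβ.antisymm fun e he => ?_
      by_contra hne
      classical
      obtain ⟨f, hf⟩ := h.exists_functional_of_isFlipCell hK hβ₀ (Pi.single e 1) (by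
        rw [Finset.sum_eq_zero, Finset.sum_eq_zero]
        · intro e' _
          by_cases he' : e' ∈ N
          · rw [Pi.single_eq_of_ne (by rintro rfl; exact hne (hN he')), mul_zero]
          · rw [indicator_of_notMem he', zero_mul]
        · intro e' _
          by_cases he' : e' ∈ A
          · rw [Pi.single_eq_of_ne (by rintro rfl; exact hne (hA he')), mul_zero]
          · rw [indicator_of_notMem he', zero_mul])
      have h0 : ∀ x ∈ Submodule.span ℝ (v '' ρ), f x = 0 := by
        intro x hx
        refine Submodule.span_induction ?_ (map_zero f) ?_ ?_ hx
        · rintro _ ⟨e', he', rfl⟩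
          rw [hf e' (hρβ he'), Pi.single_eq_of_ne]
          rintro rfl
          exact hne he'
        · intro x y _ _ hx hy; rw [map_add, hx, hy, add_zero]
        · intro a x _ hx; rw [map_smul, hx, smul_zero]
      have := hf e he
      rw [h0 _ (hspan e)] at this
      simp at this
    · refine Or.inr (Or.inr ⟨hA, hN,
        (h.isConicalTriangulation_flipComplex hK).maximal_of_spanning ⟨hN, Or.inr ⟨hA, ?_⟩⟩ hspan⟩)
      exact fun c hc => hK.down _ (h.link _ h1.prop h2 c hc) _
        (sdiff_subset_sdiff_left (union_subset hρβ (h2.trans subset_union_left)))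
  · obtain ⟨c, hc, hcρ⟩ := not_subset.1 hA
    refine Or.inr (Or.inl (hKmax (hK.down _ (h.link _ h1.prop h2 c hc) _ fun e he => ⟨hρβ he, ?_⟩)))
    rintro rfl
    exact hcρ he

/-- Two cells of a subdivision, one with the positive and one with the negative part of a circuit,
both contain the circuit. -/
theorem circuit_subset (hv : IsVertexConfiguration P v φ) (h : IsFlippable v K A N)
    {R : Set (Set E)} (hR : IsPolyhedralSubdivision P R) {B B' : Set E} (hB : B ∈ R) (hB' : B' ∈ R)
    (hA : A ⊆ v ⁻¹' B) (hN : N ⊆ v ⁻¹' B') : N ⊆ v ⁻¹' B ∧ A ⊆ v ⁻¹' B' := by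
  -- `A` and `N` have the same barycentre, which therefore lies in the common face `B ∩ B'`; this
  -- face must contain both parts of the circuit.
  obtain ⟨a, ha, ha1⟩ := exists_uniform_weights h.nonempty_pos
  have hM : weightedSum v (a • A.indicator 1) = weightedSum v (a • N.indicator 1) := by
    rw [map_smul, map_smul, h.relation]
  have hn1 : ∑ e, (a • N.indicator (1 : ι → ℝ)) e = 1 := by
    rw [← hv.height_weightedSum, ← hM, hv.height_weightedSum, ha1]
  have hnn : ∀ M : Set ι, 0 ≤ a • M.indicator (1 : ι → ℝ) := fun M =>
    smul_nonneg ha.le (indicator_one_nonneg M)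
  have hsA := support_smul_indicator_one ha A
  have hsN := support_smul_indicator_one ha N
  have hmem : weightedSum v (a • A.indicator 1) ∈ B := by
    rw [hv.eq_convexHull_of_isCell (hR.isCell B hB)]
    exact mem_convexHull_image_iff.2 ⟨_, hnn A, hsA.subset.trans hA, ha1, rfl⟩
  have hmem' : weightedSum v (a • A.indicator 1) ∈ B' := by
    rw [hv.eq_convexHull_of_isCell (hR.isCell B' hB'), hM]
    exact mem_convexHull_image_iff.2 ⟨_, hnn N, hsN.subset.trans hN, hn1, rfl⟩
  constructor
  · intro e he
    refine (mem_of_weightedSum_mem_exposed (hR.proper B hB B' hB').2 (hnn N) hn1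
      (fun e' he' => hN (hsN.subset he')) ?_ (hsN.symm.subset he)).1
    rw [← hM]; exact ⟨hmem, hmem'⟩
  · intro e he
    exact (mem_of_weightedSum_mem_exposed (hR.proper B hB B' hB').1 (hnn A) ha1
      (fun e' he' => hA (hsA.subset he')) ⟨hmem, hmem'⟩ (hsA.symm.subset he)).2

/-- A flip of the complex induces a geometric bistellar flip. -/
theorem differByBistellarFlip [FiniteDimensional ℝ E] [Nonempty ι]
    (hv : IsVertexConfiguration P v φ) (h : IsFlippable v K A N)
    (hK : IsConicalTriangulation v K) :
    DifferByBistellarFlip P (simplices v K) (simplices v (flipComplex K A N)) := by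
  have hK' := h.isConicalTriangulation_flipComplex hK
  have hT := (hv.isTriangulation_simplices hK).1
  have hT' := (hv.isTriangulation_simplices hK').1
  have hS := isPolyhedralSubdivision hv h hK
  have hinj : ∀ {σ τ : Set ι}, convexHull ℝ (v '' σ) = convexHull ℝ (v '' τ) → σ = τ := by
    intro σ τ heq
    rw [← hv.preimage_convexHull_image σ, heq, hv.preimage_convexHull_image]
  obtain ⟨τ₀, hτ₀, hNτ₀⟩ := hK.exists_maximal h.mem
  refine ⟨fun heq => ?_, _, hS, fun R => ⟨?_, ?_⟩⟩
  · have h1 : convexHull ℝ (v '' τ₀) ∈ simplices v K := ⟨τ₀, hτ₀, rfl⟩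
    rw [heq] at h1
    obtain ⟨τ', hτ', heq'⟩ := h1
    exact hτ'.prop.1 (hinj heq' ▸ hNτ₀)
  · rintro ⟨hR, href, hne⟩
    have hcell : ∀ B ∈ R, IsCell P (convexHull ℝ (v '' (v ⁻¹' B))) := fun B hB => by
      rw [← hv.eq_convexHull_of_isCell (hR.isCell B hB)]; exact hR.isCell B hB
    have hcl : ∀ B ∈ R, (A ⊆ v ⁻¹' B ∧ N ⊆ v ⁻¹' B ∧ IsFlipCell K A N (v ⁻¹' B)) ∨
        (¬ A ⊆ v ⁻¹' B ∧ Maximal (· ∈ K) (v ⁻¹' B)) ∨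
        (A ⊆ v ⁻¹' B ∧ ¬ N ⊆ v ⁻¹' B ∧ Maximal (· ∈ flipComplex K A N) (v ⁻¹' B)) := by
      intro B hB
      obtain ⟨_, ⟨β, hβ, rfl⟩, hsub⟩ := href B hB
      refine h.classification hv hK (hcell B hB) hβ ?_
      rw [← hv.preimage_convexHull_image β]
      exact preimage_mono hsub
    -- If no cell contains `A`, all cells come from `K`. If some contain `A` but none contains `N`,
    -- all come from the flipped complex. If both parts occur, they occur only together, and `R` is
    -- the coarsening itself.
    by_cases hexA : ∃ B ∈ R, A ⊆ v ⁻¹' B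
    · by_cases hexN : ∃ B ∈ R, N ⊆ v ⁻¹' B
      · obtain ⟨B₁, hB₁, hA₁⟩ := hexA
        obtain ⟨B₂, hB₂, hN₂⟩ := hexN
        have hN₁ := (h.circuit_subset hv hR hB₁ hB₂ hA₁ hN₂).1
        refine absurd (hv.subdivision_eq_of_subset hR hS fun B hB => ?_) hne
        refine ⟨v ⁻¹' B, ?_, hv.eq_convexHull_of_isCell (hR.isCell B hB)⟩
        obtain ⟨-, -, h1⟩ | ⟨h1, h2⟩ | ⟨h1, h2, -⟩ := hcl B hB
        · exact h1
        · exact Or.inl ⟨h2, fun h3 => h1 (h.circuit_subset hv hR hB₁ hB hA₁ h3).2⟩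
        · exact absurd (h.circuit_subset hv hR hB hB₁ h1 hN₁).1 h2
      · right
        refine hv.subdivision_eq_of_subset hR hT' fun B hB => ?_
        refine ⟨v ⁻¹' B, ?_, hv.eq_convexHull_of_isCell (hR.isCell B hB)⟩
        have hNB : ¬ N ⊆ v ⁻¹' B := fun h' => hexN ⟨B, hB, h'⟩
        obtain ⟨-, h1, -⟩ | ⟨-, h2⟩ | ⟨-, -, h1⟩ := hcl B hB
        · exact absurd h1 hNB
        · exact hK'.maximal_of_spanning ⟨hNB, Or.inl h2.prop⟩ (hv.mem_span_of_isCell (hcell B hB))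
        · exact h1
    · left
      refine hv.subdivision_eq_of_subset hR hT fun B hB => ?_
      refine ⟨v ⁻¹' B, ?_, hv.eq_convexHull_of_isCell (hR.isCell B hB)⟩
      obtain ⟨h1, -, -⟩ | ⟨-, h2⟩ | ⟨h1, -, -⟩ := hcl B hB
      · exact absurd ⟨B, hB, h1⟩ hexA
      · exact h2
      · exact absurd ⟨B, hB, h1⟩ hexA
  · have hB₀ : convexHull ℝ (v '' (τ₀ ∪ A)) ∈
        {B | ∃ β, IsFlipCell K A N β ∧ B = convexHull ℝ (v '' β)} :=
      ⟨_, Or.inr ⟨τ₀, hτ₀, hNτ₀, rfl⟩, rfl⟩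
    rintro (rfl | rfl)
    · refine ⟨hT, ?_, fun heq => ?_⟩
      · rintro _ ⟨τ, hτ, rfl⟩
        by_cases hN : N ⊆ τ
        · exact ⟨_, ⟨τ ∪ A, Or.inr ⟨τ, hτ, hN, rfl⟩, rfl⟩,
            convexHull_mono (image_mono subset_union_left)⟩
        · exact ⟨_, ⟨τ, Or.inl ⟨hτ, hN⟩, rfl⟩, le_rfl⟩
      · rw [← heq] at hB₀
        obtain ⟨τ, hτ, heq'⟩ := hB₀
        exact h.not_pos_subset hK hτ.prop (hinj heq' ▸ subset_union_right)
    · refine ⟨hT', ?_, fun heq => ?_⟩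
      · rintro _ ⟨τ, hτ, rfl⟩
        obtain ⟨hN, hτK | ⟨hA, hlink⟩⟩ := hτ.prop
        · obtain ⟨τ', hτ', hsub⟩ := hK.exists_maximal hτK
          by_cases hN' : N ⊆ τ'
          · exact ⟨_, ⟨τ' ∪ A, Or.inr ⟨τ', hτ', hN', rfl⟩, rfl⟩,
              convexHull_mono (image_mono (hsub.trans subset_union_left))⟩
          · exact ⟨_, ⟨τ', Or.inl ⟨hτ', hN'⟩, rfl⟩, convexHull_mono (image_mono hsub)⟩
        · obtain ⟨c, hc⟩ := h.nonempty_pos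
          obtain ⟨τ', hτ', hsub⟩ := hK.exists_maximal (hlink c hc)
          have hN' : N ⊆ τ' := by
            refine fun e he => hsub ⟨Or.inr he, ?_⟩
            rintro rfl
            exact disjoint_left.1 h.disjoint hc he
          refine ⟨_, ⟨τ' ∪ A, Or.inr ⟨τ', hτ', hN', rfl⟩, rfl⟩,
            convexHull_mono (image_mono fun e he => ?_)⟩
          by_cases hec : e = c
          · exact Or.inr (hec ▸ hc)
          · exact Or.inl (hsub ⟨Or.inl he, hec⟩)
      · rw [← heq] at hB₀
        obtain ⟨τ, hτ, heq'⟩ := hB₀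
        exact hτ.prop.1 (hinj heq' ▸ hNτ₀.trans subset_union_left)

end IsFlippable

end Flips

/-! ### The product of a triangle and a simplex, and the label orders along the edges -/

section ProductConfiguration

variable {k : ℕ}

/-- The vertices of the product of the standard simplices with `3` and with `k` vertices. -/
def productVertex (k : ℕ) (e : Fin 3 × Fin k) : (Fin 3 → ℝ) × (Fin k → ℝ) :=
  (Pi.single e.1 1, Pi.single e.2 1)

/-- The linear functional with the given values `α a + β q` at the vertices of the product. -/
noncomputable def separableFunctional (α : Fin 3 → ℝ) (β : Fin k → ℝ) :
    (Fin 3 → ℝ) × (Fin k → ℝ) →ₗ[ℝ] ℝ :=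
  (Fintype.linearCombination ℝ α).coprod (Fintype.linearCombination ℝ β)

theorem separableFunctional_apply (α : Fin 3 → ℝ) (β : Fin k → ℝ) (e : Fin 3 × Fin k) :
    separableFunctional α β (productVertex k e) = α e.1 + β e.2 := by
  simp [separableFunctional, productVertex]

theorem exists_separable (f : (Fin 3 → ℝ) × (Fin k → ℝ) →ₗ[ℝ] ℝ) :
    ∃ (α : Fin 3 → ℝ) (β : Fin k → ℝ), ∀ a q, f (productVertex k (a, q)) = α a + β q := by
  refine ⟨fun a => f (Pi.single a 1, 0), fun q => f (0, Pi.single q 1), fun a q => ?_⟩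
  rw [← map_add]
  simp [productVertex]

theorem isVertexConfiguration_productVertex (k : ℕ) :
    IsVertexConfiguration (triangleTimesSimplex k) (productVertex k)
      (separableFunctional (fun _ => 1) 0) := by
  have hhull : triangleTimesSimplex k = convexHull ℝ (range (productVertex k)) := by
    rw [triangleTimesSimplex, ← convexHull_rangle_single_eq_stdSimplex,
      ← convexHull_rangle_single_eq_stdSimplex, ← convexHull_prod, prod_range_range_eq]
    rfl
  refine ⟨fun e => by simp [separableFunctional_apply], hhull, ?_, ?_⟩
  · apply subset_antisymm
    · rw [hhull]
      exact extremePoints_convexHull_subset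
    · rintro _ ⟨e, rfl⟩
      -- The functional counts the coordinates in which a vertex agrees with `e`, minus two, so it
      -- is zero at `e` and negative elsewhere.
      have h := isExposed_convexHull_image (v := productVertex k) (ρ := {e}) (β := univ)
        (subset_univ _)
        (f := separableFunctional (Pi.single e.1 1 - fun _ => 2) (Pi.single e.2 1))
        (by rintro e' rfl; rw [separableFunctional_apply]; simp; norm_num)
        (by
          rintro ⟨a, q⟩ - hne
          rw [separableFunctional_apply]
          by_cases h1 : a = e.1
          · by_cases h2 : q = e.2
            · exact absurd (Prod.ext h1 h2) hne
            · simp [h1, h2]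
          · by_cases h2 : q = e.2
            · simp [h1, h2]
            · simp [h1, h2])
      rw [image_univ, ← hhull, image_singleton, convexHull_singleton] at h
      exact isExtreme_singleton.1 h.isExtreme
  · rintro ⟨a, q⟩ ⟨a', q'⟩ h
    have h1 := congrFun (congrArg Prod.fst h) a
    have h2 := congrFun (congrArg Prod.snd h) q
    simp only [productVertex, Pi.single_eq_same] at h1 h2
    have h3 : a = a' := by
      by_contra hne
      rw [Pi.single_eq_of_ne hne] at h1; exact one_ne_zero h1
    have h4 : q = q' := by
      by_contra hne
      rw [Pi.single_eq_of_ne hne] at h2; exact one_ne_zero h2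
    rw [h3, h4]

theorem height_productVertex (e : Fin 3 × Fin k) :
    separableFunctional (fun _ => 1) 0 (productVertex k e) = 1 :=
  (isVertexConfiguration_productVertex k).height e

theorem weightedSum_productVertex (w : Fin 3 × Fin k → ℝ) :
    weightedSum (productVertex k) w = (fun a => ∑ q, w (a, q), fun q => ∑ a, w (a, q)) := by
  rw [Fintype.linearCombination_apply, Fintype.sum_prod_type]
  ext x
  · simp [productVertex, Prod.fst_sum, Finset.sum_apply, Pi.single_apply]
  · rw [Finset.sum_comm]
    simp [productVertex, Prod.snd_sum, Finset.sum_apply, Pi.single_apply]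

theorem weightedSum_productVertex_eq_iff {w w' : Fin 3 × Fin k → ℝ} :
    weightedSum (productVertex k) w = weightedSum (productVertex k) w' ↔
      (∀ a, ∑ q, w (a, q) = ∑ q, w' (a, q)) ∧ ∀ q, ∑ a, w (a, q) = ∑ a, w' (a, q) := by
  rw [weightedSum_productVertex, weightedSum_productVertex, Prod.mk.injEq, funext_iff, funext_iff]

theorem weightedSum_indicator_insert {ι E : Type*} [Fintype ι] [NormedAddCommGroup E]
    [NormedSpace ℝ E] (v : ι → E) {e : ι} {σ : Set ι} (he : e ∉ σ) :
    weightedSum v ((insert e σ).indicator 1) = v e + weightedSum v (σ.indicator 1) := by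
  classical
  rw [insert_eq, indicator_union_of_disjoint (disjoint_singleton_left.2 he)]
  have : (fun a => ({e} : Set ι).indicator (1 : ι → ℝ) a + σ.indicator 1 a) =
      Pi.single e 1 + σ.indicator 1 := by
    ext x; by_cases h : x = e <;> simp [h]
  rw [this, map_add, weightedSum_single]

theorem weightedSum_indicator_singleton {ι E : Type*} [Fintype ι] [NormedAddCommGroup E]
    [NormedSpace ℝ E] (v : ι → E) (e : ι) :
    weightedSum v (({e} : Set ι).indicator 1) = v e := by
  rw [← insert_empty_eq, weightedSum_indicator_insert v (notMem_empty e), indicator_empty]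
  exact add_eq_left.2 (map_zero _)

theorem weightedSum_indicator_pair {ι E : Type*} [Fintype ι] [NormedAddCommGroup E]
    [NormedSpace ℝ E] (v : ι → E) {e e' : ι} (h : e ≠ e') :
    weightedSum v (({e, e'} : Set ι).indicator 1) = v e + v e' := by
  rw [weightedSum_indicator_insert v (by simpa using h), weightedSum_indicator_singleton]

theorem weightedSum_indicator_triple {ι E : Type*} [Fintype ι] [NormedAddCommGroup E]
    [NormedSpace ℝ E] (v : ι → E) {e e' e'' : ι} (h : e ≠ e') (h' : e ≠ e'') (h'' : e' ≠ e'') :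
    weightedSum v (({e, e', e''} : Set ι).indicator 1) = v e + (v e' + v e'') := by
  rw [weightedSum_indicator_insert v (by simp [h, h']), weightedSum_indicator_pair v h'']

theorem productVertex_square (a c : Fin 3) (i j : Fin k) :
    productVertex k (c, i) + productVertex k (a, j) =
      productVertex k (a, i) + productVertex k (c, j) := by
  simp only [productVertex, Prod.mk_add_mk, add_comm]

theorem square_relation {a c : Fin 3} {i j : Fin k} (hac : a ≠ c) :
    weightedSum (productVertex k) (({(c, i), (a, j)} : Set (Fin 3 × Fin k)).indicator 1) =
      weightedSum (productVertex k) (({(a, i), (c, j)} : Set (Fin 3 × Fin k)).indicator 1) := by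
  rw [weightedSum_indicator_pair _ (by simp [hac.symm]),
    weightedSum_indicator_pair _ (by simp [hac]), productVertex_square]

theorem hexagon_relation {a b c : Fin 3} {i l m : Fin k} (hab : a ≠ b) (hac : a ≠ c) (hbc : b ≠ c) :
    weightedSum (productVertex k)
        (({(c, i), (a, m), (b, l)} : Set (Fin 3 × Fin k)).indicator 1) =
      weightedSum (productVertex k)
        (({(a, i), (b, m), (c, l)} : Set (Fin 3 × Fin k)).indicator 1) := by
  rw [weightedSum_indicator_triple _ (by simp [hac.symm]) (by simp [hbc.symm]) (by simp [hab]),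
    weightedSum_indicator_triple _ (by simp [hab]) (by simp [hac]) (by simp [hbc])]
  simp only [productVertex, Prod.mk_add_mk]
  congr 1
  abel

/-- The order in which the labels are met along the edge from `a` to `b`: the label `i` has moved
on to `b` while the label `j` is still at `a`. -/
def edgeLT (K : Set (Set (Fin 3 × Fin k))) (a b : Fin 3) (i j : Fin k) : Prop :=
  i ≠ j ∧ {(b, i), (a, j)} ∈ K

variable {K : Set (Set (Fin 3 × Fin k))}

theorem edgeLT_swap {a b : Fin 3} {i j : Fin k} : edgeLT K a b i j ↔ edgeLT K b a j i := by
  rw [edgeLT, edgeLT, pair_comm, ne_comm]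

namespace IsConicalTriangulation

/-- The diagonals of a square cross in their common midpoint, which has only one representation. -/
theorem not_both_diagonals (hK : IsConicalTriangulation (productVertex k) K)
    {a c : Fin 3} {i j : Fin k} (hac : a ≠ c) (hij : i ≠ j)
    (h : {(c, i), (a, j)} ∈ K) : {(a, i), (c, j)} ∉ K := by
  intro h'
  have h1 := hK.unique _ _ (indicator_one_nonneg _) (indicator_one_nonneg _)
    (by rwa [support_indicator_one]) (by rwa [support_indicator_one]) (square_relation hac)
  have h2 := congrFun h1 (a, j)
  simp [hac, hij.symm] at h2

theorem edgeLT_asymm (hK : IsConicalTriangulation (productVertex k) K)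
    {a b : Fin 3} (hab : a ≠ b) {i j : Fin k} (h : edgeLT K a b i j) :
    ¬ edgeLT K a b j i := by
  intro h'
  refine hK.not_both_diagonals hab h.1 h.2 ?_
  rw [pair_comm]; exact h'.2

/-- Represent the sum of the endpoints of one diagonal. Its row and column sums confine the weights
to the square, where they are a mixture of the two diagonals, so at least one diagonal lies in the
support. -/
theorem edgeLT_total (hK : IsConicalTriangulation (productVertex k) K)
    {a b : Fin 3} (hab : a ≠ b) {i j : Fin k} (hij : i ≠ j) :
    edgeLT K a b i j ∨ edgeLT K a b j i := by
  obtain ⟨w, hw, hwK, hM⟩ := hK.exists_rep _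
    (indicator_one_nonneg ({(b, i), (a, j)} : Set (Fin 3 × Fin k)))
  obtain ⟨hrow, hcol⟩ := weightedSum_productVertex_eq_iff.1 hM
  have hrow0 : ∀ c, c ≠ a → c ≠ b → ∀ q, w (c, q) = 0 := by
    intro c hca hcb q
    have := hrow c
    simp only [indicator, mem_insert_iff, mem_singleton_iff, Prod.mk.injEq, hca, hcb, false_and,
      or_self, if_false, Finset.sum_const_zero] at this
    exact (Finset.sum_eq_zero_iff_of_nonneg fun q _ => hw (c, q)).1 this q (Finset.mem_univ q)
  have hcolsum : ∀ q, w (a, q) + w (b, q) = ∑ c, w (c, q) := fun q =>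
    (Fintype.sum_eq_add a b hab fun c hc => hrow0 c hc.1 hc.2 q).symm
  have hi : w (a, i) + w (b, i) = 1 := by
    rw [hcolsum, hcol, Fintype.sum_eq_single b]
    · simp
    · intro c hc; simp [hc, hij]
  have hj : w (a, j) + w (b, j) = 1 := by
    rw [hcolsum, hcol, Fintype.sum_eq_single a]
    · simp
    · intro c hc; simp [hc, hij.symm]
  have ha : w (a, i) + w (a, j) ≤ 1 := by
    have h1 : ∑ q, w (a, q) = 1 := by
      rw [hrow, Fintype.sum_eq_single j]
      · simp
      · intro q hq; simp [hq, hab]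
    rw [← h1, ← Finset.sum_pair (f := fun q => w (a, q)) hij]
    exact Finset.sum_le_sum_of_subset_of_nonneg (Finset.subset_univ _) fun q _ _ => hw (a, q)
  have hb : w (b, i) + w (b, j) ≤ 1 := by
    have h1 : ∑ q, w (b, q) = 1 := by
      rw [hrow, Fintype.sum_eq_single i]
      · simp
      · intro q hq; simp [hq, hab.symm]
    rw [← h1, ← Finset.sum_pair (f := fun q => w (b, q)) hij]
    exact Finset.sum_le_sum_of_subset_of_nonneg (Finset.subset_univ _) fun q _ _ => hw (b, q)
  by_cases h0 : w (b, i) = 0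
  · right
    refine ⟨hij.symm, hK.down _ hwK _ (pair_subset ?_ ?_)⟩ <;> rw [mem_support] <;> intro h <;>
      linarith
  · by_cases h1 : w (a, j) = 0
    · right
      refine ⟨hij.symm, hK.down _ hwK _ (pair_subset ?_ ?_)⟩ <;> rw [mem_support] <;> intro h <;>
        linarith
    · exact Or.inl ⟨hij, hK.down _ hwK _ (pair_subset h0 h1)⟩

/-- For a cyclic triple, represent the vector with sum 3 in each of the rows `a`, `b` and sum 2 in
each of the three columns. As opposite diagonals exclude each other, `q` before `r` forces `w (a, q)
= 0` or `w (a, r) = 2`. Around the cycle, the entries of row `a` are then all 0 or all 2, with sum 0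
or 6 instead of 3. -/
theorem edgeLT_trans (hK : IsConicalTriangulation (productVertex k) K)
    {a b : Fin 3} (hab : a ≠ b) {i j l : Fin k} (h : edgeLT K a b i j)
    (h' : edgeLT K a b j l) : edgeLT K a b i l := by
  have hil : i ≠ l := by
    rintro rfl
    exact hK.edgeLT_asymm hab h h'
  refine (hK.edgeLT_total hab hil).resolve_right fun h'' => ?_
  have hij := h.1
  have hjl := h'.1
  obtain ⟨w, hw, hwK, hM⟩ := hK.exists_rep
    (fun e => (if e.1 = a ∨ e.1 = b then 1 else 0) * (if e.2 = i ∨ e.2 = j ∨ e.2 = l then 1 else 0))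
    (fun e => by dsimp only; split_ifs <;> simp)
  obtain ⟨hrow, hcol⟩ := weightedSum_productVertex_eq_iff.1 hM
  have hrow0 : ∀ c, c ≠ a → c ≠ b → ∀ q, w (c, q) = 0 := by
    intro c hca hcb q
    have := hrow c
    simp only [hca, hcb, or_self, if_false, zero_mul, Finset.sum_const_zero] at this
    exact (Finset.sum_eq_zero_iff_of_nonneg fun q _ => hw (c, q)).1 this q (Finset.mem_univ q)
  have hcol0 : ∀ q, q ≠ i → q ≠ j → q ≠ l → ∀ c, w (c, q) = 0 := by
    intro q h1 h2 h3 c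
    have := hcol q
    simp only [h1, h2, h3, or_self, if_false, mul_zero, Finset.sum_const_zero] at this
    exact (Finset.sum_eq_zero_iff_of_nonneg fun c _ => hw (c, q)).1 this c (Finset.mem_univ c)
  have hcolsum : ∀ q, (q = i ∨ q = j ∨ q = l) → w (a, q) + w (b, q) = 2 := fun q hq => by
    rw [← Fintype.sum_eq_add a b hab fun c hc => hrow0 c hc.1 hc.2 q, hcol,
      Fintype.sum_eq_add a b hab fun c hc => by simp [hc.1, hc.2]]
    simp [hq]; norm_num
  have htriple : ∀ g : Fin k → ℝ, (∀ q, q ≠ i → q ≠ j → q ≠ l → g q = 0) →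
      ∑ q, g q = g i + (g j + g l) := by
    intro g hg
    rw [← Finset.sum_subset (Finset.subset_univ {i, j, l}), Finset.sum_insert (by simp [hij, hil]),
      Finset.sum_pair hjl]
    intro q _ hq
    simp only [Finset.mem_insert, Finset.mem_singleton, not_or] at hq
    exact hg q hq.1 hq.2.1 hq.2.2
  have hrowa : w (a, i) + (w (a, j) + w (a, l)) = 3 := by
    rw [← htriple (fun q => w (a, q)) fun q h1 h2 h3 => hcol0 q h1 h2 h3 a, hrow,
      htriple _ fun q h1 h2 h3 => by simp [h1, h2, h3]]
    simp; norm_num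
  have hex : ∀ q r, edgeLT K a b q r → w (a, q) = 0 ∨ w (b, r) = 0 := by
    intro q r hqr
    by_contra hne
    rw [not_or] at hne
    exact hK.not_both_diagonals hab hqr.1 hqr.2 (hK.down _ hwK _ (pair_subset hne.1 hne.2))
  have h1 := hcolsum i (by simp)
  have h2 := hcolsum j (by simp)
  have h3 := hcolsum l (by simp)
  rcases hex i j h with h4 | h4 <;> rcases hex j l h' with h5 | h5 <;>
    rcases hex l i h'' with h6 | h6 <;> linarith

end IsConicalTriangulation

end ProductConfiguration

/-! ### Interchanging two adjacent labels along one edge -/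

section Sweep

variable {k : ℕ}

/-- One flip of conical triangulations of the product of simplices. -/
def FlipStep (K K' : Set (Set (Fin 3 × Fin k))) : Prop :=
  ∃ A N, IsFlippable (productVertex k) K A N ∧ K' = flipComplex K A N

/-- The maximal faces that contain the edge `(a, i), (c, j)` but no other vertex of the square
spanned by `(a, i), (c, i), (a, j), (c, j)`. -/
def obstructions (K : Set (Set (Fin 3 × Fin k))) (a c : Fin 3) (i j : Fin k) :
    Set (Set (Fin 3 × Fin k)) :=
  {τ | Maximal (· ∈ K) τ ∧ (a, i) ∈ τ ∧ (c, j) ∈ τ ∧ (c, i) ∉ τ ∧ (a, j) ∉ τ}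

variable {K : Set (Set (Fin 3 × Fin k))}

theorem flipComplex_pair_mem_iff {ι : Type*} {K : Set (Set ι)} {A N : Set ι} (e e' : ι)
    (hA : ¬ A ⊆ {e, e'}) (hN : ¬ N ⊆ {e, e'}) : {e, e'} ∈ flipComplex K A N ↔ {e, e'} ∈ K :=
  ⟨fun h => h.2.resolve_right fun h' => hA h'.1, fun h => ⟨hN, Or.inl h⟩⟩

theorem not_triple_subset_pair {ι : Type*} {x y z : ι} (hxy : x ≠ y) (hxz : x ≠ z) (hyz : y ≠ z)
    (e e' : ι) : ¬ ({x, y, z} : Set ι) ⊆ {e, e'} := by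
  intro h
  have hx := h (show x ∈ ({x, y, z} : Set ι) by simp)
  have hy := h (show y ∈ ({x, y, z} : Set ι) by simp)
  have hz := h (show z ∈ ({x, y, z} : Set ι) by simp)
  simp only [mem_insert_iff, mem_singleton_iff] at hx hy hz
  grind

theorem pair_subset_pair_iff {ι : Type*} {x y e e' : ι} (hxy : x ≠ y) :
    ({x, y} : Set ι) ⊆ {e, e'} ↔ ({e, e'} : Set ι) = {x, y} := by
  refine ⟨fun h => ?_, fun h => h ▸ le_rfl⟩
  have hx := h (show x ∈ ({x, y} : Set ι) by simp)
  have hy := h (show y ∈ ({x, y} : Set ι) by simp)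
  simp only [mem_insert_iff, mem_singleton_iff] at hx hy
  rw [Set.pair_eq_pair_iff]
  grind

namespace IsConicalTriangulation

/-- The functional that picks the coefficient of `e` on a maximal face. -/
theorem exists_coefficient (hK : IsConicalTriangulation (productVertex k) K)
    {τ : Set (Fin 3 × Fin k)} (hτ : τ ∈ K) {e : Fin 3 × Fin k} (he : e ∈ τ) :
    ∃ (f : (Fin 3 → ℝ) × (Fin k → ℝ) →ₗ[ℝ] ℝ) (α : Fin 3 → ℝ) (β : Fin k → ℝ),
      (∀ a q, f (productVertex k (a, q)) = α a + β q) ∧ α e.1 + β e.2 = 1 ∧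
      ∀ a q, (a, q) ∈ τ → (a, q) ≠ e → α a + β q = 0 := by
  classical
  obtain ⟨f, hf⟩ := hK.exists_functional hτ (Pi.single e 1)
  obtain ⟨α, β, h⟩ := exists_separable f
  refine ⟨f, α, β, h, ?_, fun a q haq hne => ?_⟩
  · rw [← h, hf _ he]; simp
  · rw [← h, hf _ haq, Pi.single_eq_of_ne hne]

theorem separable_eq_zero (hK : IsConicalTriangulation (productVertex k) K)
    {τ : Set (Fin 3 × Fin k)} (hτ : Maximal (· ∈ K) τ) {α : Fin 3 → ℝ} {β : Fin k → ℝ}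
    (h : ∀ a q, (a, q) ∈ τ → α a + β q = 0) (a : Fin 3) (q : Fin k) : α a + β q = 0 := by
  rw [← separableFunctional_apply α β (a, q)]
  refine hK.functional_eq_zero height_productVertex hτ (fun e he => ?_) (a, q)
  rw [separableFunctional_apply]
  exact h e.1 e.2 he

theorem exists_mem_label (hK : IsConicalTriangulation (productVertex k) K)
    {τ : Set (Fin 3 × Fin k)} (hτ : Maximal (· ∈ K) τ) (q : Fin k) : ∃ a, (a, q) ∈ τ := by
  by_contra h
  push Not at h
  have := hK.separable_eq_zero hτ (α := 0) (β := Pi.single q 1) (fun a r har => by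
    rw [Pi.single_eq_of_ne (by rintro rfl; exact h a har)]; simp) 0 q
  simp at this

/-- Without obstructions a square can be flipped. -/
theorem isFlippable_square (hK : IsConicalTriangulation (productVertex k) K) {a c : Fin 3}
    {i j : Fin k} (hac : a ≠ c) (hij : edgeLT K c a i j) (hW : obstructions K a c i j = ∅) :
    IsFlippable (productVertex k) K {(c, i), (a, j)} {(a, i), (c, j)} := by
  have hne := hij.1
  have hA : ({(c, i), (a, j)} : Set (Fin 3 × Fin k)) ∉ K :=
    hK.not_both_diagonals hac.symm hne hij.2
  -- Cross the facet of `τ` opposite to `e`, towards `e'`. The new maximal face still contains the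
  -- diagonal; as it is no obstruction and `e` has left, the entering vertex is `e'`.
  have hswap : ∀ τ e e', Maximal (· ∈ K) τ → (a, i) ∈ τ → (c, j) ∈ τ →
      ({(c, i), (a, j)} : Set (Fin 3 × Fin k)) = {e, e'} → e ∈ τ → insert e' (τ \ {e}) ∈ K := by
    intro τ e e' hτ hai hcj hAe he
    have hee : e' ∉ τ := fun h => hA (hK.down _ hτ.prop _ (hAe ▸ pair_subset he h))
    have hsum : productVertex k e + productVertex k e' =
        productVertex k (a, i) + productVertex k (c, j) := by
      rw [← productVertex_square]
      rcases Set.pair_eq_pair_iff.1 hAe with ⟨rfl, rfl⟩ | ⟨rfl, rfl⟩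
      · rfl
      · rw [add_comm]
    have hae : (a, i) ≠ e ∧ (c, j) ≠ e := by
      rcases Set.pair_eq_pair_iff.1 hAe with ⟨rfl, rfl⟩ | ⟨rfl, rfl⟩ <;>
        simp [hac, hac.symm, hne, hne.symm]
    obtain ⟨f, α, β, hf, he1, h0⟩ := hK.exists_coefficient hτ.prop he
    have hfe : f (productVertex k e) = 1 := by rw [← he1, ← hf]
    have hfe' : f (productVertex k e') < 0 := by
      have := congrArg f hsum
      rw [map_add, map_add, hf a, hf c, h0 _ _ hai hae.1, h0 _ _ hcj hae.2, hfe] at this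
      linarith
    obtain ⟨x, hx, hmax⟩ := hK.exists_exchange height_productVertex hτ (e := e)
      (fun y hy => by rw [← h0 y.1 y.2 hy.1 hy.2, ← hf]) hfe'
    have hxe : x ≠ e := by
      rintro rfl; rw [hfe] at hx; linarith
    have hnot : ¬ ((c, i) ∉ insert x (τ \ {e}) ∧ (a, j) ∉ insert x (τ \ {e})) := fun h => by
      have : insert x (τ \ {e}) ∈ obstructions K a c i j :=
        ⟨hmax, Or.inr ⟨hai, hae.1⟩, Or.inr ⟨hcj, hae.2⟩, h.1, h.2⟩
      rw [hW] at this
      exact this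
    have hmem : e ∈ insert x (τ \ {e}) ∨ e' ∈ insert x (τ \ {e}) := by
      by_contra hcon
      rw [not_or] at hcon
      rcases Set.pair_eq_pair_iff.1 hAe with ⟨rfl, rfl⟩ | ⟨rfl, rfl⟩
      · exact hnot hcon
      · exact hnot hcon.symm
    rcases hmem with (h | h) | (h | h)
    · exact absurd h.symm hxe
    · exact absurd rfl h.2
    · rw [h]; exact hmax.prop
    · exact absurd h.1 hee
  refine ⟨?_, insert_nonempty _ _, insert_nonempty _ _, square_relation hac, hij.2, ?_⟩
  · simp [hac, hac.symm, hne, hne.symm]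
  · intro σ hσ hN x hx
    obtain ⟨τ, hτ, hστ⟩ := hK.exists_maximal hσ
    have hai : (a, i) ∈ τ := hστ (hN (by simp))
    have hcj : (c, j) ∈ τ := hστ (hN (by simp))
    have hmem : ∃ e e', ({(c, i), (a, j)} : Set (Fin 3 × Fin k)) = {e, e'} ∧ e ∈ τ := by
      by_cases h1 : (c, i) ∈ τ
      · exact ⟨_, _, rfl, h1⟩
      · by_cases h2 : (a, j) ∈ τ
        · exact ⟨_, _, pair_comm _ _, h2⟩
        · have : τ ∈ obstructions K a c i j := ⟨hτ, hai, hcj, h1, h2⟩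
          rw [hW] at this
          exact absurd this (notMem_empty τ)
    obtain ⟨e, e', hAe, he⟩ := hmem
    rw [hAe] at hx ⊢
    rcases hx with rfl | rfl
    · refine hK.down _ (hswap τ x e' hτ hai hcj hAe he) _ ?_
      rintro y ⟨hy | rfl | rfl, hyx⟩
      · exact Or.inr ⟨hστ hy, hyx⟩
      · exact absurd rfl hyx
      · exact Or.inl rfl
    · refine hK.down _ hτ.prop _ ?_
      rintro y ⟨hy | rfl | rfl, hyx⟩
      · exact hστ hy
      · exact he
      · exact absurd rfl hyx

/-- The three simplices of one triangulation of a hexagonal circuit allow a flip. -/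
theorem isFlippable_hexagon (hK : IsConicalTriangulation (productVertex k) K) {a b c : Fin 3}
    (hab : a ≠ b) (hac : a ≠ c) (hbc : b ≠ c) (hcov : ∀ x, x = a ∨ x = b ∨ x = c)
    {i l m : Fin k} (hil : i ≠ l) (him : i ≠ m) (hlm : l ≠ m) {τ : Set (Fin 3 × Fin k)}
    (hτ : Maximal (· ∈ K) τ) (hai : (a, i) ∈ τ) (hci : (c, i) ∉ τ) (hcl : (c, l) ∈ τ)
    (hbl : (b, l) ∈ τ) (hbm : (b, m) ∈ τ) (ham : (a, m) ∈ τ)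
    (h1 : insert (c, i) (τ \ {(a, m)}) ∈ K) (h2 : insert (c, i) (τ \ {(b, l)}) ∈ K) :
    IsFlippable (productVertex k) K {(c, i), (a, m), (b, l)} {(a, i), (b, m), (c, l)} := by
  have hdisj : Disjoint ({(c, i), (a, m), (b, l)} : Set (Fin 3 × Fin k))
      {(a, i), (b, m), (c, l)} := by
    simp [hab, hab.symm, hac, hac.symm, hbc, hbc.symm, hil, hil.symm, him, him.symm, hlm, hlm.symm]
  have hNτ : ({(a, i), (b, m), (c, l)} : Set (Fin 3 × Fin k)) ⊆ τ := by
    rintro e (rfl | rfl | rfl) <;> assumption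
  have hrel := hexagon_relation (k := k) (i := i) (l := l) (m := m) hab hac hbc
  refine ⟨hdisj, insert_nonempty _ _, insert_nonempty _ _, hrel,
    hK.down _ hτ.prop _ hNτ, ?_⟩
  set A : Set (Fin 3 × Fin k) := {(c, i), (a, m), (b, l)} with hA
  set N : Set (Fin 3 × Fin k) := {(a, i), (b, m), (c, l)} with hN
  have hAτ : A ⊆ insert (c, i) τ := by
    rintro e (rfl | rfl | rfl)
    · exact Or.inl rfl
    · exact Or.inr ham
    · exact Or.inr hbl
  have hlink : ∀ x ∈ A, insert (c, i) τ \ {x} ∈ K := by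
    rintro x (rfl | rfl | rfl)
    · refine hK.down _ hτ.prop _ ?_
      rintro y ⟨rfl | hy, hne⟩
      · exact absurd rfl hne
      · exact hy
    · refine hK.down _ h1 _ ?_
      rintro y ⟨rfl | hy, hne⟩
      · exact Or.inl rfl
      · exact Or.inr ⟨hy, hne⟩
    · refine hK.down _ h2 _ ?_
      rintro y ⟨rfl | hy, hne⟩
      · exact Or.inl rfl
      · exact Or.inr ⟨hy, hne⟩
  intro σ hσ hNσ x hx
  suffices ∃ x₀ ∈ A, σ ⊆ insert (c, i) τ \ {x₀} by
    obtain ⟨x₀, -, hsub⟩ := this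
    exact hK.down _ (hlink x hx) _
      (sdiff_subset_sdiff_left (union_subset (hsub.trans sdiff_subset) hAτ))
  obtain ⟨u, hu, hMu⟩ := hK.exists_support_subset height_productVertex hτ (indicator_one_nonneg σ)
  -- The path `(c, l)`, `(b, l)`, `(b, m)`, `(a, m)` in `τ` joins the three rows and avoids `e`, so
  -- the coefficient functional of `e` does not depend on the row. Every label occurs in `τ`, hence
  -- the functional is nowhere negative.
  have hunn : ∀ e ∈ τ, e ∉ A → e ∉ N → 0 ≤ u e := by
    intro e he heA heN
    obtain ⟨f, α, β, hf, he1, h0⟩ := hK.exists_coefficient hτ.prop he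
    have hne : ∀ y ∈ A ∪ N, y ≠ e := by
      rintro y (hy | hy) rfl
      · exact heA hy
      · exact heN hy
    have e1 := h0 _ _ hcl (hne _ (by simp [hN]))
    have e2 := h0 _ _ hbl (hne _ (by simp [hA]))
    have e3 := h0 _ _ hbm (hne _ (by simp [hN]))
    have e4 := h0 _ _ ham (hne _ (by simp [hA]))
    have hα : ∀ x y, α x = α y := by
      intro x y
      rcases hcov x with rfl | rfl | rfl <;> rcases hcov y with rfl | rfl | rfl <;> linarith
    have hfnn : ∀ x q, 0 ≤ α x + β q := by
      intro x q
      obtain ⟨y, hy⟩ := hK.exists_mem_label hτ q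
      rw [hα x y]
      by_cases hye : (y, q) = e
      · rw [← hye] at he1
        rw [he1]; exact zero_le_one
      · rw [h0 _ _ hy hye]
    have h3 := congrArg f hMu
    rw [apply_weightedSum, apply_weightedSum, Finset.sum_eq_single e] at h3
    · have h4 : f (productVertex k e) = 1 := by rw [← he1, ← hf]
      rw [h4, mul_one] at h3
      rw [h3]
      refine Finset.sum_nonneg fun y _ => mul_nonneg (indicator_one_nonneg σ y) ?_
      rw [← Prod.mk.eta (p := y), hf]
      exact hfnn _ _
    · intro y _ hye
      by_cases hy : y ∈ τ
      · rw [← Prod.mk.eta (p := y), hf, h0 _ _ hy hye, mul_zero]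
      · rw [notMem_support.1 fun h => hy (hu h), zero_mul]
    · simp
  set t : ℝ := ∑ e, |u e| with ht
  have htu : ∀ e, -t ≤ u e := fun e => by
    have : |u e| ≤ t := Finset.single_le_sum (f := fun e => |u e|) (fun e _ => abs_nonneg _)
      (Finset.mem_univ e)
    linarith [neg_abs_le (u e)]
  have ht0 : 0 ≤ t := Finset.sum_nonneg fun e _ => abs_nonneg _
  have hAN : ∀ e, e ∈ A → e ∉ N := fun e h h' => disjoint_left.1 hdisj h h'
  -- Adding `t` on the circuit makes `u` nonnegative. By the circuit relation the result represents
  -- the same vector as `σ` plus `2 * t` times `N`, whose support is `σ`. A shift along the circuit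
  -- frees some `x₀ ∈ A`, and uniqueness puts `σ` into the corresponding simplex.
  obtain ⟨w₀, hw₀def⟩ : ∃ w₀ : Fin 3 × Fin k → ℝ, w₀ = u + t • (A.indicator 1 + N.indicator 1) :=
    ⟨_, rfl⟩
  have hw₀ : 0 ≤ w₀ := by
    intro e
    rw [hw₀def]
    change 0 ≤ u e + t * (A.indicator 1 e + N.indicator 1 e)
    by_cases hA' : e ∈ A
    · simp only [hA', hAN e hA', indicator_of_mem, indicator_of_notMem, not_false_eq_true,
        Pi.one_apply]
      linarith [htu e]
    · by_cases hN' : e ∈ N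
      · simp only [hA', hN', indicator_of_mem, indicator_of_notMem, not_false_eq_true,
          Pi.one_apply]
        linarith [htu e]
      · simp only [hA', hN', indicator_of_notMem, not_false_eq_true]
        by_cases hτe : e ∈ τ
        · linarith [hunn e hτe hA' hN']
        · rw [notMem_support.1 fun h => hτe (hu h)]; simp
  obtain ⟨x₀, hx₀, hw₁, hx₀s, hsub, -, hM₁⟩ :=
    exists_shift hdisj.symm (insert_nonempty _ _) hrel.symm hw₀
  have hsupp₀ : support w₀ ⊆ insert (c, i) τ := by
    rw [hw₀def]
    refine (support_add _ _).trans (union_subset (hu.trans (subset_insert _ _)) ?_)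
    refine (support_const_smul_subset _ _).trans ((support_add _ _).trans ?_)
    rw [support_indicator_one, support_indicator_one]
    exact union_subset hAτ (hNτ.trans (subset_insert _ _))
  set w₁ := w₀ + w₀ x₀ • (N.indicator 1 - A.indicator 1)
  have hsupp₁ : support w₁ ⊆ insert (c, i) τ \ {x₀} := by
    intro e he
    refine ⟨(hsub.trans (union_subset hsupp₀ (hNτ.trans (subset_insert _ _)))) he, ?_⟩
    rintro rfl
    exact hx₀s he
  have hσsupp : support (σ.indicator 1 + (2 * t) • N.indicator (1 : Fin 3 × Fin k → ℝ)) = σ := by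
    ext e
    rw [mem_support]
    change σ.indicator 1 e + 2 * t * N.indicator 1 e ≠ 0 ↔ e ∈ σ
    by_cases he : e ∈ σ
    · simp only [he, indicator_of_mem, Pi.one_apply, iff_true]
      have := mul_nonneg (mul_nonneg zero_le_two ht0) (indicator_one_nonneg N e)
      exact (add_pos_of_pos_of_nonneg one_pos this).ne'
    · have : e ∉ N := fun h => he (hNσ h)
      simp [he, this]
  have heq : w₁ = σ.indicator 1 + (2 * t) • N.indicator 1 := by
    refine hK.unique _ _ hw₁ (add_nonneg (indicator_one_nonneg σ)
      (smul_nonneg (by positivity) (indicator_one_nonneg N)))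
      (hK.down _ (hlink x₀ hx₀) _ hsupp₁) (by rwa [hσsupp]) ?_
    rw [hM₁, hw₀def, map_add, map_smul, map_add, hrel, hMu, map_add, map_smul, ← two_smul ℝ, smul_smul,
      mul_comm]
  exact ⟨x₀, hx₀, by rw [← hσsupp, ← heq]; exact hsupp₁⟩

/-- An obstruction of a flip of a square with adjacent labels can be removed by a flip. -/
theorem exists_isFlippable_hexagon (hK : IsConicalTriangulation (productVertex k) K)
    {a b c : Fin 3} (hab : a ≠ b) (hac : a ≠ c) (hbc : b ≠ c) (hcov : ∀ x, x = a ∨ x = b ∨ x = c)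
    {i j : Fin k} (hij : edgeLT K c a i j) (hadj : ∀ m, ¬ (edgeLT K c a i m ∧ edgeLT K c a m j))
    (hb : edgeLT K c b j i) (hW : (obstructions K a c i j).Nonempty) :
    ∃ τ ∈ obstructions K a c i j, ∃ l m : Fin k, (a, i) ∈ τ ∧ (b, m) ∈ τ ∧ (c, l) ∈ τ ∧
      IsFlippable (productVertex k) K {(c, i), (a, m), (b, l)} {(a, i), (b, m), (c, l)} := by
  classical
  -- The potential is the number of vertices in row `c` minus the number in row `a`. For an
  -- obstruction that maximizes it, the neighbours required by the hexagon flip are present.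
  let s : Fin 3 → ℝ := fun x => if x = c then 1 else if x = a then -1 else 0
  have hsa : s a = -1 := by simp [s, hac]
  have hsb : s b = 0 := by simp [s, hbc, hab.symm]
  have hsc : s c = 1 := by simp [s]
  let pot : Set (Fin 3 × Fin k) → ℝ := fun τ => ∑ e, τ.indicator 1 e * s e.1
  obtain ⟨τ, hτW, hpot⟩ := exists_max_image (obstructions K a c i j) pot (toFinite _) hW
  obtain ⟨hτ, hai, hcj, hci, haj⟩ := hτW
  have hbi : (b, i) ∉ τ := fun h => by
    refine hK.not_both_diagonals hbc.symm hij.1.symm hb.2 ?_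
    rw [pair_comm]
    exact hK.down _ hτ.prop _ (pair_subset h hcj)
  have hca : ∀ q, (c, q) ∈ τ → (a, q) ∉ τ := by
    intro q hc ha
    have hqi : i ≠ q := by rintro rfl; exact hci hc
    have hqj : q ≠ j := by rintro rfl; exact haj ha
    exact hadj q ⟨⟨hqi, hK.down _ hτ.prop _ (pair_subset hai hc)⟩,
      ⟨hqj, hK.down _ hτ.prop _ (pair_subset ha hcj)⟩⟩
  -- A spanning face is a connected bipartite graph of rows and labels. Rows `a` and `c` share no
  -- label, so each of them shares one with `b`; otherwise a functional vanishes on `τ` but not at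
  -- `(c, i)`.
  obtain ⟨l, hcl, hbl⟩ : ∃ l, (c, l) ∈ τ ∧ (b, l) ∈ τ := by
    by_contra hne
    push Not at hne
    have := hK.separable_eq_zero hτ (α := Pi.single c 1)
      (β := fun q => -(if (c, q) ∈ τ then 1 else 0)) (fun x q hxq => by
        rcases hcov x with rfl | rfl | rfl
        · have : (c, q) ∉ τ := fun h => hca q h hxq
          simp [this, hac]
        · have : (c, q) ∉ τ := fun h => hne q h hxq
          simp [this, hbc]
        · simp [hxq]) c i
    simp [hci] at this
  obtain ⟨m, ham, hbm⟩ : ∃ m, (a, m) ∈ τ ∧ (b, m) ∈ τ := by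
    by_contra hne
    push Not at hne
    have := hK.separable_eq_zero hτ (α := Pi.single a 1)
      (β := fun q => -(if (a, q) ∈ τ then 1 else 0)) (fun x q hxq => by
        rcases hcov x with rfl | rfl | rfl
        · simp [hxq]
        · have : (a, q) ∉ τ := fun h => hne q h hxq
          simp [this, hab.symm]
        · have : (a, q) ∉ τ := hca q hxq
          simp [this, hac.symm]) c i
    simp [hai, hac.symm] at this
  have hil : i ≠ l := by rintro rfl; exact hbi hbl
  have him : i ≠ m := by rintro rfl; exact hbi hbm
  have hmj : m ≠ j := by rintro rfl; exact haj ham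
  have hlm : l ≠ m := by rintro rfl; exact hca l hcl ham
  -- Cross the facet opposite to `e` towards `(c, i)`. The entering vertex raises the potential and,
  -- not being in row `a`, cannot be `(a, j)`. Were it different from `(c, i)`, the new face would
  -- be an obstruction of larger potential.
  have hexch : ∀ e ∈ τ, e ≠ (a, i) → e ≠ (c, j) →
      ∀ (f : (Fin 3 → ℝ) × (Fin k → ℝ) →ₗ[ℝ] ℝ) (α : Fin 3 → ℝ) (β : Fin k → ℝ),
      (∀ x q, f (productVertex k (x, q)) = α x + β q) →
      (∀ x q, (x, q) ∈ τ → (x, q) ≠ e → α x + β q = 0) → α e.1 + β e.2 = 1 → α c < α a →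
      (∀ x q, α x + β q < 0 → x ≠ a ∧ s e.1 < s x) → insert (c, i) (τ \ {e}) ∈ K := by
    intro e he hea hec f α β hf h0 he1 hαc hneg
    have hfp : f (productVertex k (c, i)) < 0 := by
      rw [hf]
      have := h0 a i hai hea.symm
      linarith
    obtain ⟨⟨x, q⟩, hx, hmax⟩ := hK.exists_exchange height_productVertex hτ (e := e)
      (fun y hy => by rw [← h0 y.1 y.2 hy.1 hy.2, ← hf]) hfp
    rw [hf] at hx
    obtain ⟨hxa, hsx⟩ := hneg x q hx
    have hxe : (x, q) ≠ e := by
      rintro rfl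
      exact lt_irrefl _ hsx
    have hxτ : (x, q) ∉ τ := fun h => by
      rw [h0 x q h hxe] at hx; exact lt_irrefl _ hx
    have hpotlt : pot τ < pot (insert (x, q) (τ \ {e})) := by
      have hind : ∀ y, (insert (x, q) (τ \ {e})).indicator (1 : Fin 3 × Fin k → ℝ) y * s y.1 =
          τ.indicator 1 y * s y.1 + (Pi.single (x, q) (s x) - Pi.single e (s e.1) :
            Fin 3 × Fin k → ℝ) y := by
        intro y
        by_cases hy1 : y = (x, q)
        · subst hy1; simp [hxτ, hxe]
        · by_cases hy2 : y = e
          · subst hy2; simp [hy1, he]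
          · by_cases hy3 : y ∈ τ <;> simp [hy1, hy2, hy3]
      have hd : pot (insert (x, q) (τ \ {e})) = pot τ + (s x - s e.1) := by
        simp only [pot, hind, Finset.sum_add_distrib]
        simp
      rw [hd]; linarith
    have hci' : (c, i) ∈ insert (x, q) (τ \ {e}) := by
      by_contra hci'
      have haj' : (a, j) ∉ insert (x, q) (τ \ {e}) := by
        rintro (h | h)
        · exact hxa (congrArg Prod.fst h).symm
        · exact haj h.1
      exact absurd (hpot _ ⟨hmax, Or.inr ⟨hai, hea.symm⟩, Or.inr ⟨hcj, hec.symm⟩, hci', haj'⟩)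
        (not_le.2 hpotlt)
    rcases hci' with h | h
    · rw [h]; exact hmax.prop
    · exact absurd h.1 hci
  -- Each label carries a vertex of `τ`, where the functional is 0 or 1, and moving to a row with
  -- the largest `α` does not decrease it.
  have hcoef : ∀ e ∈ τ, ∀ (α : Fin 3 → ℝ) (β : Fin k → ℝ),
      (∀ x q, (x, q) ∈ τ → (x, q) ≠ e → α x + β q = 0) → α e.1 + β e.2 = 1 →
      ∀ x q, (∀ y, α y ≤ α x) → 0 ≤ α x + β q := by
    intro e he α β h0 he1 x q hx
    obtain ⟨y, hy⟩ := hK.exists_mem_label hτ q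
    by_cases hye : (y, q) = e
    · rw [← hye] at he1
      simp only at he1
      linarith [hx y]
    · linarith [h0 y q hy hye, hx y]
  have h1 : insert (c, i) (τ \ {(a, m)}) ∈ K := by
    obtain ⟨f, α, β, hf, he1, h0⟩ := hK.exists_coefficient hτ.prop ham
    have e1 := h0 _ _ hcl (by simp [hac.symm])
    have e2 := h0 _ _ hbl (by simp [hab.symm])
    have e3 := h0 _ _ hbm (by simp [hab.symm])
    simp only at he1
    refine hexch (a, m) ham (by simp [him.symm]) (by simp [hac]) f α β hf h0 he1 (by linarith) ?_
    intro x q hx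
    have hxa : x ≠ a := by
      rintro rfl
      refine absurd (hcoef _ ham α β h0 he1 x q fun y => ?_) (not_le.2 hx)
      rcases hcov y with rfl | rfl | rfl <;> linarith
    refine ⟨hxa, ?_⟩
    rcases hcov x with rfl | rfl | rfl
    · exact absurd rfl hxa
    · simp only [hsa, hsb]; norm_num
    · simp only [hsa, hsc]; norm_num
  have h2 : insert (c, i) (τ \ {(b, l)}) ∈ K := by
    obtain ⟨f, α, β, hf, he1, h0⟩ := hK.exists_coefficient hτ.prop hbl
    have e1 := h0 _ _ hcl (by simp [hbc.symm])
    have e2 := h0 _ _ hbm (by simp [hlm.symm])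
    have e3 := h0 _ _ ham (by simp [hab])
    simp only at he1
    refine hexch (b, l) hbl (by simp [hab.symm]) (by simp [hbc]) f α β hf h0 he1 (by linarith) ?_
    intro x q hx
    have hxc : x = c := by
      rcases hcov x with rfl | rfl | rfl
      · refine absurd (hcoef _ hbl α β h0 he1 x q fun y => ?_) (not_le.2 hx)
        rcases hcov y with rfl | rfl | rfl <;> linarith
      · refine absurd (hcoef _ hbl α β h0 he1 x q fun y => ?_) (not_le.2 hx)
        rcases hcov y with rfl | rfl | rfl <;> linarith
      · rfl
    rw [hxc]
    refine ⟨hac.symm, ?_⟩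
    simp only [hsb, hsc]; norm_num
  exact ⟨τ, ⟨hτ, hai, hcj, hci, haj⟩, l, m, hai, hbm, hcl,
    hK.isFlippable_hexagon hab hac hbc hcov hil him hlm hτ hai hci hcl hbl hbm ham h1 h2⟩

/-- Two labels that are adjacent along one edge of the triangle and in the opposite order along
another edge, as seen from the common vertex `c`, can be interchanged along the first edge. -/
theorem exists_flips_swap (hK : IsConicalTriangulation (productVertex k) K)
    {a b c : Fin 3} (hab : a ≠ b) (hac : a ≠ c) (hbc : b ≠ c) (hcov : ∀ x, x = a ∨ x = b ∨ x = c)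
    {i j : Fin k} (hij : edgeLT K c a i j) (hadj : ∀ m, ¬ (edgeLT K c a i m ∧ edgeLT K c a m j))
    (hb : edgeLT K c b j i) :
    ∃ K', Relation.ReflTransGen FlipStep K K' ∧ IsConicalTriangulation (productVertex k) K' ∧
      ∀ e e', ({e, e'} ∈ K' ↔ ({e, e'} ∈ K ∧ ({e, e'} : Set (Fin 3 × Fin k)) ≠ {(a, i), (c, j)}) ∨
        ({e, e'} : Set (Fin 3 × Fin k)) = {(c, i), (a, j)}) := by
  induction hn : (obstructions K a c i j).ncard using Nat.strong_induction_on generalizing K with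
  | _ n ih =>
  subst hn
  by_cases hW : (obstructions K a c i j).Nonempty
  · obtain ⟨τ, hτ, l, m, hai, hbm, hcl, hflip⟩ :=
      hK.exists_isFlippable_hexagon hab hac hbc hcov hij hadj hb hW
    have hK₁ := hflip.isConicalTriangulation_flipComplex hK
    set K₁ := flipComplex K {(c, i), (a, m), (b, l)} {(a, i), (b, m), (c, l)} with hK₁def
    have hpair : ∀ e e', {e, e'} ∈ K₁ ↔ {e, e'} ∈ K := fun e e' =>
      flipComplex_pair_mem_iff e e'
        (not_triple_subset_pair (by simp [hac.symm]) (by simp [hbc.symm]) (by simp [hab]) e e')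
        (not_triple_subset_pair (by simp [hab]) (by simp [hac]) (by simp [hbc]) e e')
    have hlt : ∀ x y q r, edgeLT K₁ x y q r ↔ edgeLT K x y q r := fun x y q r => by
      rw [edgeLT, edgeLT, hpair]
    -- The flip creates no obstruction, because its new faces contain `(c, i)`, and it destroys `τ`,
    -- which contains the removed face.
    have hsub : obstructions K₁ a c i j ⊆ obstructions K a c i j \ {τ} := by
      rintro τ' ⟨hτ', h1, h2, h3, h4⟩
      have hτK : τ' ∈ K := hτ'.prop.2.resolve_right fun h => h3 (h.1 (by simp))
      refine ⟨⟨hK.maximal_of_spanning hτK (hK₁.mem_span_of_maximal height_productVertex hτ'),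
        h1, h2, h3, h4⟩, ?_⟩
      rintro rfl
      refine hτ'.prop.1 ?_
      rintro e (rfl | rfl | rfl) <;> assumption
    have hcard : (obstructions K₁ a c i j).ncard < (obstructions K a c i j).ncard :=
      (ncard_le_ncard hsub (toFinite _)).trans_lt (ncard_sdiff_singleton_lt_of_mem hτ (toFinite _))
    obtain ⟨K', hreach, hK', hiff⟩ := ih _ hcard hK₁ ((hlt _ _ _ _).2 hij)
      (fun m => by rw [hlt, hlt]; exact hadj m) ((hlt _ _ _ _).2 hb) rfl
    refine ⟨K', Relation.ReflTransGen.head ⟨_, _, hflip, rfl⟩ hreach, hK', fun e e' => ?_⟩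
    rw [hiff, hpair]
  · rw [not_nonempty_iff_eq_empty] at hW
    have hflip := hK.isFlippable_square hac hij hW
    refine ⟨_, Relation.ReflTransGen.single ⟨_, _, hflip, rfl⟩,
      hflip.isConicalTriangulation_flipComplex hK, fun e e' => ?_⟩
    have hne1 : (c, i) ≠ (a, j) := by simp [hac.symm]
    have hne2 : (a, i) ≠ (c, j) := by simp [hac]
    constructor
    · rintro ⟨hN, h | ⟨h, -⟩⟩
      · exact Or.inl ⟨h, fun h' => hN h'.ge⟩
      · exact Or.inr ((pair_subset_pair_iff hne1).1 h)
    · rintro (⟨h, hne⟩ | h)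
      · exact ⟨fun h' => hne ((pair_subset_pair_iff hne2).1 h'), Or.inl h⟩
      · rw [h]
        refine ⟨fun h' => ?_, Or.inr ⟨le_rfl, fun x hx => ?_⟩⟩
        · have := h' (show (a, i) ∈ _ from Or.inl rfl)
          simp [hac, hij.1] at this
        · rw [union_comm]
          exact hflip.link _ hij.2 le_rfl x hx

end IsConicalTriangulation

end Sweep

/-! ### Sorting the orders, and the staircase triangulation -/

section Staircase

variable {k : ℕ}

/-- If a strict total order differs from another relation, then some adjacent pair is inverted. -/
theorem exists_adjacent_inversion {ι : Type*} [Finite ι] {r s : ι → ι → Prop}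
    (hrirr : ∀ i, ¬ r i i) (hrtrans : ∀ i j l, r i j → r j l → r i l)
    (hstrans : ∀ i j l, s i j → s j l → s i l) (hstot : ∀ i j, i ≠ j → s i j ∨ s j i)
    (hex : ∃ i j, r i j ∧ s j i) :
    ∃ i j, r i j ∧ s j i ∧ ∀ m, ¬ (r i m ∧ r m j) := by
  obtain ⟨i₀, j₀, h₀⟩ := hex
  -- Take an inverted pair with the fewest elements in between. An element `m` in between would
  -- form, with `i` or with `j`, an inverted pair with fewer.
  obtain ⟨⟨i, j⟩, ⟨hr, hs⟩, hmin⟩ := exists_min_image {p : ι × ι | r p.1 p.2 ∧ s p.2 p.1}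
    (fun p => {m | r p.1 m ∧ r m p.2}.ncard) (toFinite _) ⟨(i₀, j₀), h₀⟩
  refine ⟨i, j, hr, hs, fun m hm => ?_⟩
  have him : i ≠ m := by
    rintro rfl; exact hrirr i hm.1
  rcases hstot i m him with h | h
  · refine absurd (hmin (m, j) ⟨hm.2, hstrans _ _ _ hs h⟩) (not_le.2 ?_)
    refine ncard_lt_ncard ⟨fun x hx => ⟨hrtrans _ _ _ hm.1 hx.1, hx.2⟩, fun h' => ?_⟩ (toFinite _)
    exact hrirr m (h' (show m ∈ {x | r i x ∧ r x j} from hm)).1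
  · refine absurd (hmin (i, m) ⟨hm.1, h⟩) (not_le.2 ?_)
    refine ncard_lt_ncard ⟨fun x hx => ⟨hx.1, hrtrans _ _ _ hx.2 hm.2⟩, fun h' => ?_⟩ (toFinite _)
    exact hrirr m (h' (show m ∈ {x | r i x ∧ r x j} from hm)).2

namespace IsConicalTriangulation

variable {K : Set (Set (Fin 3 × Fin k))}

/-- Every order that is intermediate between the order along the edge from `c` to `a` and the
opposite of the order along the edge from `c` to `b` can be reached along the first edge. -/
theorem exists_flips_sort {a b c : Fin 3} (hab : a ≠ b) (hac : a ≠ c) (hbc : b ≠ c)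
    (hcov : ∀ x, x = a ∨ x = b ∨ x = c) {ν : Fin k → Fin k → Prop}
    (hνirr : ∀ i, ¬ ν i i) (hνtrans : ∀ i j l, ν i j → ν j l → ν i l)
    (hνtot : ∀ i j, i ≠ j → ν i j ∨ ν j i) (hK : IsConicalTriangulation (productVertex k) K)
    (hν : ∀ q r, edgeLT K c a q r → ν r q → edgeLT K c b r q) :
    ∃ K', Relation.ReflTransGen FlipStep K K' ∧ IsConicalTriangulation (productVertex k) K' ∧
      (∀ q r, edgeLT K' c a q r ↔ ν q r) ∧ (∀ q r, edgeLT K' c b q r ↔ edgeLT K c b q r) ∧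
      ∀ q r, edgeLT K' a b q r ↔ edgeLT K a b q r := by
  induction hn : {p : Fin k × Fin k | edgeLT K c a p.1 p.2 ∧ ν p.2 p.1}.ncard
    using Nat.strong_induction_on generalizing K with
  | _ n ih =>
  subst hn
  by_cases hex : ∃ i j, edgeLT K c a i j ∧ ν j i
  · obtain ⟨i, j, hij, hji, hadj⟩ := exists_adjacent_inversion (r := edgeLT K c a)
      (fun i h => h.1 rfl) (fun _ _ _ => hK.edgeLT_trans hac.symm) hνtrans hνtot hex
    obtain ⟨K₁, hreach, hK₁, hiff⟩ := hK.exists_flips_swap hab hac hbc hcov hij hadj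
      (hν i j hij hji)
    have hca : ∀ q r, edgeLT K₁ c a q r ↔
        (edgeLT K c a q r ∧ (q, r) ≠ (i, j)) ∨ (q, r) = (j, i) := by
      intro q r
      have h1 := hij.1
      simp only [edgeLT, hiff, Set.pair_eq_pair_iff, Prod.mk.injEq, hac, hac.symm, false_and, or_false, false_or, true_and, ne_eq]
      constructor
      · rintro ⟨h, h' | h'⟩
        · exact Or.inl ⟨⟨h, h'.1⟩, h'.2⟩
        · exact Or.inr h'
      · rintro (⟨⟨h, h'⟩, h''⟩ | ⟨rfl, rfl⟩)
        · exact ⟨h, Or.inl ⟨h', h''⟩⟩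
        · exact ⟨h1.symm, Or.inr ⟨rfl, rfl⟩⟩
    have hcb : ∀ q r, edgeLT K₁ c b q r ↔ edgeLT K c b q r := by
      intro q r
      simp [edgeLT, hiff, Set.pair_eq_pair_iff, hab.symm, hbc]
    have hab' : ∀ q r, edgeLT K₁ a b q r ↔ edgeLT K a b q r := by
      intro q r
      simp [edgeLT, hiff, Set.pair_eq_pair_iff, hab.symm, hbc]
    have hlt : {p : Fin k × Fin k | edgeLT K₁ c a p.1 p.2 ∧ ν p.2 p.1}.ncard <
        {p : Fin k × Fin k | edgeLT K c a p.1 p.2 ∧ ν p.2 p.1}.ncard := by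
      refine ncard_lt_ncard ⟨?_, fun h => ?_⟩ (toFinite _)
      · rintro ⟨q, r⟩ ⟨h, h'⟩
        rcases (hca q r).1 h with h | h
        · exact ⟨h.1, h'⟩
        · obtain ⟨rfl, rfl⟩ := Prod.mk.inj h
          exact absurd (hνtrans _ _ _ h' hji) (hνirr _)
      · have := (h (show (i, j) ∈ {p : Fin k × Fin k | edgeLT K c a p.1 p.2 ∧ ν p.2 p.1} from
          ⟨hij, hji⟩)).1
        rcases (hca i j).1 this with h' | h'
        · exact h'.2 rfl
        · exact hij.1 (Prod.mk.inj h').1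
    obtain ⟨K', hreach', hK', h1, h2, h3⟩ := ih _ hlt hK₁ (fun q r h h' => by
      rw [hcb]
      rcases (hca q r).1 h with h | h
      · exact hν q r h.1 h'
      · obtain ⟨rfl, rfl⟩ := Prod.mk.inj h
        exact absurd (hνtrans _ _ _ h' hji) (hνirr _)) rfl
    exact ⟨K', hreach.trans hreach', hK', h1, fun q r => (h2 q r).trans (hcb q r),
      fun q r => (h3 q r).trans (hab' q r)⟩
  · push Not at hex
    have hle : ∀ q r, edgeLT K c a q r → ν q r := fun q r h =>
      (hνtot q r h.1).resolve_right (hex q r h)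
    refine ⟨K, Relation.ReflTransGen.refl, hK, fun q r => ⟨hle q r, fun h => ?_⟩,
      fun _ _ => Iff.rfl, fun _ _ => Iff.rfl⟩
    have hqr : q ≠ r := by rintro rfl; exact hνirr q h
    exact (hK.edgeLT_total hac.symm hqr).resolve_right fun h' => hex r q h' h

/-- Variant of `exists_flips_sort`: the order along one edge of the triangle can be made equal to
the order along another one. -/
theorem exists_flips_copy {a b c : Fin 3} (hab : a ≠ b) (hac : a ≠ c) (hbc : b ≠ c)
    (hcov : ∀ x, x = a ∨ x = b ∨ x = c) (hK : IsConicalTriangulation (productVertex k) K) :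
    ∃ K', Relation.ReflTransGen FlipStep K K' ∧ IsConicalTriangulation (productVertex k) K' ∧
      (∀ q r, edgeLT K' c a q r ↔ edgeLT K c b q r) ∧
      (∀ q r, edgeLT K' c b q r ↔ edgeLT K c b q r) ∧
      ∀ q r, edgeLT K' a b q r ↔ edgeLT K a b q r :=
  exists_flips_sort hab hac hbc hcov (fun _ h => h.1 rfl)
    (fun _ _ _ => hK.edgeLT_trans hbc.symm) (fun _ _ => hK.edgeLT_total hbc.symm) hK
    fun _ _ _ h => h

end IsConicalTriangulation

/-- The ordering `1, 2, 0` of the vertices of the triangle. -/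
def staircaseRank : Fin 3 → ℕ := ![2, 0, 1]

/-- A monotone lattice path, as a set of cells of the grid. -/
def IsStaircase (σ : Set (Fin 3 × Fin k)) : Prop :=
  ∀ e ∈ σ, ∀ e' ∈ σ, e.2 < e'.2 → staircaseRank e.1 ≤ staircaseRank e'.1

theorem staircaseRank_injective : Injective staircaseRank := by
  decide

/-- Look at the first difference, by label and then by rank. A surplus at `(x, q)` is compensated in
column `q` at a row `y` of larger rank and in row `x` at a later label `r`. The other weight then
has both `(y, q)` and `(x, r)` in its support, which is no staircase. -/
theorem staircase_weights_unique {w w' : Fin 3 × Fin k → ℝ} (hw : 0 ≤ w) (hw' : 0 ≤ w')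
    (hs : IsStaircase (support w)) (hs' : IsStaircase (support w'))
    (hM : weightedSum (productVertex k) w = weightedSum (productVertex k) w') : w = w' := by
  have key : ∀ u u' : Fin 3 × Fin k → ℝ, 0 ≤ u → 0 ≤ u' → IsStaircase (support u') →
      weightedSum (productVertex k) u = weightedSum (productVertex k) u' → ∀ x q, u' (x, q) < u (x, q) →
      (∀ y, u y ≠ u' y → q ≤ y.2) →
      (∀ y, u (y, q) ≠ u' (y, q) → staircaseRank x ≤ staircaseRank y) → False := by
    intro u u' hu hu' hsu hMu x q hlt hq hx
    obtain ⟨hrow, hcol⟩ := weightedSum_productVertex_eq_iff.1 hMu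
    obtain ⟨y, -, hy⟩ : ∃ y ∈ Finset.univ, u (y, q) < u' (y, q) := by
      by_contra hne
      push Not at hne
      exact (Finset.sum_lt_sum hne ⟨x, Finset.mem_univ x, hlt⟩).ne (hcol q).symm
    obtain ⟨r, -, hr⟩ : ∃ r ∈ Finset.univ, u (x, r) < u' (x, r) := by
      by_contra hne
      push Not at hne
      exact (Finset.sum_lt_sum hne ⟨q, Finset.mem_univ q, hlt⟩).ne (hrow x).symm
    have hqr : q < r := by
      refine lt_of_le_of_ne (hq (x, r) hr.ne) ?_
      rintro rfl
      exact lt_asymm hlt hr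
    have hxy : staircaseRank x < staircaseRank y := by
      refine lt_of_le_of_ne (hx y hy.ne) fun h => ?_
      rw [staircaseRank_injective h] at hlt
      exact lt_asymm hlt hy
    exact absurd (hsu (y, q) ((hu (y, q)).trans_lt hy).ne' (x, r) ((hu (x, r)).trans_lt hr).ne' hqr)
      (not_le.2 hxy)
  by_contra hne
  obtain ⟨y₀, hy₀⟩ := ne_iff.1 hne
  obtain ⟨⟨y₁, q⟩, hq, hqmin⟩ := exists_min_image {y | w y ≠ w' y} (fun y => y.2) (toFinite _)
    ⟨y₀, hy₀⟩
  obtain ⟨x, hx, hxmin⟩ := exists_min_image {y | w (y, q) ≠ w' (y, q)} staircaseRank (toFinite _)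
    ⟨y₁, hq⟩
  rcases lt_or_gt_of_ne hx with h | h
  · exact key w' w hw' hw hs hM.symm x q h (fun y hy => hqmin y hy.symm)
      fun y hy => hxmin y hy.symm
  · exact key w w' hw hw' hs' hM x q h hqmin hxmin

theorem IsStaircase.mono {σ ρ : Set (Fin 3 × Fin k)} (hσ : IsStaircase σ) (h : ρ ⊆ σ) :
    IsStaircase ρ :=
  fun e he e' he' => hσ e (h he) e' (h he')

/-- The staircase triangulation. -/
theorem isConicalTriangulation_staircase (k : ℕ) :
    IsConicalTriangulation (productVertex k) {σ | IsStaircase σ} := by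
  refine ⟨fun σ hσ ρ h => IsStaircase.mono hσ h, fun w hw => ?_,
    fun w w' hw hw' hs hs' => staircase_weights_unique hw hw' hs hs'⟩
  set S : Set (Fin 3 × Fin k → ℝ) :=
    {u | 0 ≤ u ∧ weightedSum (productVertex k) u = weightedSum (productVertex k) w} with hS
  have hcont : Continuous (weightedSum (productVertex k)) := by
    simp only [weightedSum, Fintype.linearCombination, LinearMap.coe_mk, AddHom.coe_mk]
    fun_prop
  have hclosed : IsClosed S :=
    (isClosed_le continuous_const continuous_id).inter (isClosed_eq hcont continuous_const)
  have hsub : S ⊆ Icc 0 fun _ => ∑ e, w e := by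
    rintro u ⟨hu, hM⟩
    refine ⟨hu, fun e => ?_⟩
    have hv := isVertexConfiguration_productVertex k
    rw [← hv.height_weightedSum, ← hM, hv.height_weightedSum]
    exact Finset.single_le_sum (fun e _ => hu e) (Finset.mem_univ e)
  -- The staircase triangulation is regular, with rank times label as heights. A maximizer over the
  -- compact fibre has staircase support: a shift along the square of a violating pair would gain
  -- the shifted weight times `(rank x - rank y) * (r - q)`.
  obtain ⟨u, ⟨hu, hMu⟩, hmax⟩ := (isCompact_Icc.of_isClosed_subset hclosed hsub).exists_isMaxOn
    ⟨w, hw, rfl⟩ (f := fun u => ∑ e, u e * ((staircaseRank e.1 : ℝ) * (e.2 : ℝ)))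
    (Continuous.continuousOn (by fun_prop))
  refine ⟨u, hu, ?_, hMu⟩
  rintro ⟨x, q⟩ hxq ⟨y, r⟩ hyr hqr
  by_contra hlt
  rw [not_le] at hlt
  simp only at hqr hlt
  have hxy : x ≠ y := by rintro rfl; exact lt_irrefl _ hlt
  have hd : Disjoint ({(x, r), (y, q)} : Set (Fin 3 × Fin k)) {(y, r), (x, q)} := by
    simp [hxy, hxy.symm, hqr.ne, hqr.ne']
  obtain ⟨e, he, hnn, -, -, -, hM⟩ := exists_shift hd (insert_nonempty _ _)
    (square_relation hxy.symm) hu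
  have hle := hmax (show _ ∈ S from ⟨hnn, hM.trans hMu⟩)
  have hpos : 0 < u e := by
    rcases he with rfl | rfl
    · exact (hu _).lt_of_ne' hyr
    · exact (hu _).lt_of_ne' hxq
  have hpair : ∀ e e' : Fin 3 × Fin k, e ≠ e' →
      ∑ z, ({e, e'} : Set (Fin 3 × Fin k)).indicator (1 : Fin 3 × Fin k → ℝ) z *
        ((staircaseRank z.1 : ℝ) * (z.2 : ℝ)) =
      (staircaseRank e.1 : ℝ) * (e.2 : ℝ) + (staircaseRank e'.1 : ℝ) * (e'.2 : ℝ) := by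
    intro e e' hee
    rw [Fintype.sum_eq_add e e' hee]
    · simp
    · intro z hz; simp [hz.1, hz.2]
  simp only [mem_ofPred_eq, Pi.add_apply, Pi.smul_apply, Pi.sub_apply, smul_eq_mul, add_mul,
    Finset.sum_add_distrib, mul_assoc, sub_mul, mul_sub, Finset.sum_sub_distrib,
    ← Finset.mul_sum] at hle
  rw [hpair _ _ (by simp [hxy]), hpair _ _ (by simp [hxy.symm])] at hle
  have h1 : (staircaseRank y : ℝ) < staircaseRank x := by exact_mod_cast hlt
  have h2 : (q : ℝ) < (r : ℝ) := by exact_mod_cast hqr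
  have h3 := mul_pos hpos (mul_pos (sub_pos.2 h1) (sub_pos.2 h2))
  nlinarith

namespace IsConicalTriangulation

variable {K : Set (Set (Fin 3 × Fin k))}

/-- The orders along the edges of the triangle characterize the staircase triangulation. -/
theorem eq_staircase (hK : IsConicalTriangulation (productVertex k) K)
    (h02 : ∀ q r, edgeLT K 0 2 q r ↔ q < r) (h01 : ∀ q r, edgeLT K 0 1 q r ↔ q < r)
    (h12 : ∀ q r, edgeLT K 1 2 q r ↔ r < q) : K = {σ | IsStaircase σ} := by
  have hsub : ∀ σ ∈ K, IsStaircase σ := by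
    rintro σ hσ ⟨x, q⟩ hx ⟨y, r⟩ hy hqr
    simp only at hqr ⊢
    by_contra hlt
    rw [not_le] at hlt
    have hmem : ∀ {z z'}, (z, r) ∈ σ → (z', q) ∈ σ → edgeLT K z' z r q := fun hz hz' =>
      ⟨hqr.ne', hK.down _ hσ _ (pair_subset hz hz')⟩
    fin_cases x <;> fin_cases y <;> simp [staircaseRank] at hlt
    · exact lt_asymm hqr ((h01 _ _).1 (hmem hy hx))
    · exact lt_asymm hqr ((h02 _ _).1 (hmem hy hx))
    · exact lt_asymm hqr ((h12 _ _).1 (edgeLT_swap.1 (hmem hy hx)))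
  -- A conical triangulation inside another is equal to it: the sum over a face `σ` of the larger
  -- one is represented in the smaller one, and uniqueness shows that `σ` is the support.
  refine subset_antisymm hsub fun σ hσ => ?_
  obtain ⟨w, hw, hwK, hM⟩ := hK.exists_rep _ (indicator_one_nonneg σ)
  have := staircase_weights_unique hw (indicator_one_nonneg σ) (hsub _ hwK)
    (by rwa [support_indicator_one]) hM
  rw [this, support_indicator_one] at hwK
  exact hwK

/-- Every conical triangulation is connected to the staircase triangulation. -/
theorem reflTransGen_staircase (hK : IsConicalTriangulation (productVertex k) K) :
    Relation.ReflTransGen FlipStep K {σ | IsStaircase σ} := by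
  -- Let `π` be the order from 0 to 1. Two copies make the order from 0 to 2 equal to `π` and that
  -- from 1 to 2 its reverse, so the orders from 2 to 0 and from 2 to 1 are opposite. Any order can
  -- then be sorted into the edge between 2 and 0; two more copies spread it to the other edges.
  obtain ⟨K₁, r₁, hK₁, p₁, p₂, p₃⟩ := hK.exists_flips_copy (a := 2) (b := 1) (c := 0)
    (by decide) (by decide) (by decide) (by decide)
  obtain ⟨K₂, r₂, hK₂, q₁, q₂, q₃⟩ := hK₁.exists_flips_copy (a := 2) (b := 0) (c := 1)
    (by decide) (by decide) (by decide) (by decide)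
  obtain ⟨K₃, r₃, hK₃, s₁, s₂, s₃⟩ := exists_flips_sort (a := 0) (b := 1) (c := 2)
    (by decide) (by decide) (by decide) (by decide) (ν := fun q r => r < q)
    (fun _ => lt_irrefl _) (fun _ _ _ h h' => h'.trans h) (fun _ _ h => (lt_or_gt_of_ne h).symm)
    hK₂ (fun q r h _ => by
      rw [← edgeLT_swap, q₁, edgeLT_swap]
      exact (p₂ r q).2 ((p₁ r q).1 (edgeLT_swap.1 ((q₃ q r).1 h))))
  obtain ⟨K₄, r₄, hK₄, t₁, t₂, t₃⟩ := hK₃.exists_flips_copy (a := 1) (b := 2) (c := 0)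
    (by decide) (by decide) (by decide) (by decide)
  obtain ⟨K₅, r₅, hK₅, u₁, u₂, u₃⟩ := hK₄.exists_flips_copy (a := 2) (b := 0) (c := 1)
    (by decide) (by decide) (by decide) (by decide)
  have h02 : ∀ q r, edgeLT K₃ 0 2 q r ↔ q < r := fun q r => by rw [edgeLT_swap, s₁]
  have h01 : ∀ q r, edgeLT K₄ 0 1 q r ↔ q < r := fun q r => (t₁ q r).trans (h02 q r)
  rw [← hK₅.eq_staircase (fun q r => ?_) (fun q r => ?_) (fun q r => ?_)]
  · exact r₁.trans (r₂.trans (r₃.trans (r₄.trans r₅)))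
  · rw [edgeLT_swap, u₃, edgeLT_swap, t₂, h02]
  · rw [edgeLT_swap, u₂, edgeLT_swap, h01]
  · rw [u₁, edgeLT_swap, h01]

end IsConicalTriangulation

/-- The graph of triangulations of the product of a triangle and a simplex is connected. -/
theorem bistellarFlipGraph_connected (k : ℕ) (hk : 1 ≤ k) :
    (bistellarFlipGraph (triangleTimesSimplex k)).Connected := by
  have : Nonempty (Fin 3 × Fin k) := ⟨(0, ⟨0, hk⟩)⟩
  have hv := isVertexConfiguration_productVertex k
  have hS := isConicalTriangulation_staircase k
  have key : ∀ K K', IsConicalTriangulation (productVertex k) K →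
      Relation.ReflTransGen FlipStep K K' → ∀ (hT : IsTriangulation _ (simplices _ K))
      (hT' : IsTriangulation _ (simplices _ K')),
      (bistellarFlipGraph (triangleTimesSimplex k)).Reachable ⟨simplices (productVertex k) K, hT⟩
        ⟨simplices (productVertex k) K', hT'⟩ := by
    intro K K' hK hreach
    induction hreach using Relation.ReflTransGen.head_induction_on with
    | refl => exact fun _ _ => SimpleGraph.Reachable.refl _
    | head hstep _ ih =>
      intro hT hT'
      obtain ⟨A, N, hflip, rfl⟩ := hstep
      have hK₁ := hflip.isConicalTriangulation_flipComplex hK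
      refine SimpleGraph.Reachable.trans (SimpleGraph.Adj.reachable ?_)
        (ih hK₁ (hv.isTriangulation_simplices hK₁) hT')
      exact hflip.differByBistellarFlip hv hK
  have hbase := hv.isTriangulation_simplices hS
  have hall : ∀ T, (bistellarFlipGraph (triangleTimesSimplex k)).Reachable T
      ⟨simplices (productVertex k) {σ | IsStaircase σ}, hbase⟩ := by
    rintro ⟨T, hT⟩
    obtain ⟨K, hK, rfl⟩ := hv.exists_eq_simplices hT
    exact key K _ hK hK.reflTransGen_staircase hT hbase
  have : Nonempty {T // IsTriangulation (triangleTimesSimplex k) T} := ⟨⟨_, hbase⟩⟩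
  exact ⟨fun T T' => (hall T).trans (hall T').symm⟩

end Staircase

/-! ### Labeled lozenge tilings and trapezoid flips -/

section LozengeTilings

namespace UnitTriangle

theorem adjacent_up_down_iff {a b c d : ℕ} :
    (up a b).Adjacent (down c d) ↔
      (a = c ∧ b = d) ∨ (a = c + 1 ∧ b = d) ∨ (a = c ∧ b = d + 1) := by
  constructor
  · intro h
    obtain ⟨x, y, hxy, h⟩ := Finset.card_eq_two.1 h
    have hx : x ∈ (up a b).vertices ∩ (down c d).vertices := by rw [h]; simp
    have hy : y ∈ (up a b).vertices ∩ (down c d).vertices := by rw [h]; simp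
    obtain ⟨x₁, x₂⟩ := x
    obtain ⟨y₁, y₂⟩ := y
    simp only [vertices, Finset.mem_inter, Finset.mem_insert, Finset.mem_singleton, Prod.mk.injEq,
      ne_eq] at hx hy hxy
    omega
  · rintro (⟨rfl, rfl⟩ | ⟨rfl, rfl⟩ | ⟨rfl, rfl⟩)
    · refine Finset.card_eq_two.2 ⟨(a + 1, b), (a, b + 1), by simp, ?_⟩
      ext ⟨x, y⟩
      simp only [vertices, Finset.mem_inter, Finset.mem_insert, Finset.mem_singleton,
        Prod.mk.injEq]
      omega
    · refine Finset.card_eq_two.2 ⟨(c + 1, b), (c + 1, b + 1), by simp, ?_⟩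
      ext ⟨x, y⟩
      simp only [vertices, Finset.mem_inter, Finset.mem_insert, Finset.mem_singleton,
        Prod.mk.injEq]
      omega
    · refine Finset.card_eq_two.2 ⟨(a, d + 1), (a + 1, d + 1), by simp, ?_⟩
      ext ⟨x, y⟩
      simp only [vertices, Finset.mem_inter, Finset.mem_insert, Finset.mem_singleton,
        Prod.mk.injEq]
      omega

theorem inSize_up_iff {k i j : ℕ} : (up i j).InSize k ↔ i + j + 1 ≤ k := by
  simp only [InSize, vertices, Finset.mem_insert, Finset.mem_singleton, forall_eq_or_imp, forall_eq]
  omega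

theorem inSize_down_iff {k i j : ℕ} : (down i j).InSize k ↔ i + j + 2 ≤ k := by
  simp only [InSize, vertices, Finset.mem_insert, Finset.mem_singleton, forall_eq_or_imp, forall_eq]
  omega

theorem IsUpward.ne_of_isDownward {u d : UnitTriangle} (hu : u.IsUpward) (hd : d.IsDownward) :
    u ≠ d := by
  obtain ⟨i, j, rfl⟩ := hu
  obtain ⟨i', j', rfl⟩ := hd
  simp

/-- The row of the triangular grid in which a unit triangle lies. -/
def row : UnitTriangle → ℕ
  | up _ j => j
  | down _ j => j

end UnitTriangle

open UnitTriangle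

namespace LabeledLozengeTiling

variable {k : ℕ} (L : LabeledLozengeTiling k)

theorem singleton_mem (t : Fin k) : {L.triangle t} ∈ L.tiles :=
  L.bijOn.mapsTo (mem_univ t)

theorem isUpward_of_singleton_mem {u : UnitTriangle} (hu : {u} ∈ L.tiles) :
    u.IsUpward ∧ u.InSize k := by
  rcases L.isTiling.isTile _ hu with ⟨u', d, hu', hd, -, -, -, h⟩ | ⟨u', hu', hs, h⟩
  · have h1 : u' ∈ ({u} : Set UnitTriangle) := by rw [h]; simp
    have h2 : d ∈ ({u} : Set UnitTriangle) := by rw [h]; simp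
    exact absurd (h1.trans h2.symm) (hu'.ne_of_isDownward hd)
  · rw [singleton_eq_singleton_iff] at h
    exact h ▸ ⟨hu', hs⟩

theorem eq_of_mem {t : UnitTriangle} (ht : t.InSize k) {B B' : Set UnitTriangle}
    (hB : B ∈ L.tiles) (hB' : B' ∈ L.tiles) (htB : t ∈ B) (htB' : t ∈ B') : B = B' :=
  (L.isTiling.partition t ht).unique ⟨hB, htB⟩ ⟨hB', htB'⟩

/-- Every downward triangle is part of a lozenge. -/
theorem exists_partner {d : UnitTriangle} (hd : d.IsDownward) (hs : d.InSize k) :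
    ∃ u : UnitTriangle, u.IsUpward ∧ u.InSize k ∧ u.Adjacent d ∧ {u, d} ∈ L.tiles := by
  obtain ⟨B, ⟨hB, hdB⟩, -⟩ := L.isTiling.partition d hs
  rcases L.isTiling.isTile _ hB with ⟨u, d', hu, -, hus, -, hadj, rfl⟩ | ⟨u, hu, -, rfl⟩
  · rcases hdB with h | h
    · exact absurd h.symm (hu.ne_of_isDownward hd)
    · rw [mem_singleton_iff] at h
      subst h
      exact ⟨u, hu, hus, hadj, hB⟩
  · exact absurd hdB.symm (hu.ne_of_isDownward hd)

/-- An upward tile can be moved across every adjacent downward triangle. -/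
theorem exists_flip (t : Fin k) {u' d : UnitTriangle} (hu' : u'.IsUpward) (hus' : u'.InSize k)
    (hd : d.IsDownward) (hds : d.InSize k) (hadj : (L.triangle t).Adjacent d)
    (hadj' : u'.Adjacent d) (hmem : {u', d} ∈ L.tiles) :
    ∃ L' : LabeledLozengeTiling k, (trapezoidFlipGraph k).Adj L L' ∧
      L'.triangle = update L.triangle t u' ∧ {L.triangle t, d} ∈ L'.tiles := by
  classical
  set u := L.triangle t with hudef
  have hmemu : {u} ∈ L.tiles := L.singleton_mem t
  obtain ⟨hu, hus⟩ := L.isUpward_of_singleton_mem hmemu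
  have hud := hu.ne_of_isDownward hd
  have hud' := hu'.ne_of_isDownward hd
  have hne : u ≠ u' := by
    intro h
    have h1 := L.eq_of_mem hus hmemu hmem rfl (Or.inl h)
    have h2 : d ∈ ({u} : Set UnitTriangle) := by rw [h1]; simp
    exact hud h2.symm
  have hnot : {u'} ∉ L.tiles := by
    intro h
    have h1 := L.eq_of_mem hus' h hmem rfl (Or.inl rfl)
    have h2 : d ∈ ({u'} : Set UnitTriangle) := by rw [h1]; simp
    exact hud' h2.symm
  set S : Set (Set UnitTriangle) := (L.tiles \ {{u}, {u', d}}) ∪ {{u'}, {u, d}} with hS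
  have hsing : ∀ x, {x} ∈ S ↔ ({x} ∈ L.tiles ∧ x ≠ u) ∨ x = u' := by
    intro x
    have h1 : ({x} : Set UnitTriangle) ≠ {u', d} := fun h => by
      have h1 : u' ∈ ({x} : Set UnitTriangle) := by rw [h]; simp
      have h2 : d ∈ ({x} : Set UnitTriangle) := by rw [h]; simp
      exact hud' (h1.trans h2.symm)
    have h2 : ({x} : Set UnitTriangle) ≠ {u, d} := fun h => by
      have h1 : u ∈ ({x} : Set UnitTriangle) := by rw [h]; simp
      have h2 : d ∈ ({x} : Set UnitTriangle) := by rw [h]; simp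
      exact hud (h1.trans h2.symm)
    simp only [hS, mem_union, mem_sdiff, mem_insert_iff, mem_singleton_iff, h1, h2, or_false,
      singleton_eq_singleton_iff]
  have htiling : IsLozengeTiling k S := by
    constructor
    · rintro B (⟨hB, -⟩ | rfl | rfl)
      · exact L.isTiling.isTile B hB
      · exact Or.inr ⟨u', hu', hus', rfl⟩
      · exact Or.inl ⟨u, d, hu, hd, hus, hds, hadj, rfl⟩
    · intro x hx
      by_cases hxu : x = u
      · refine ⟨{u, d}, ⟨Or.inr (Or.inr rfl), Or.inl hxu⟩, ?_⟩
        rintro B ⟨⟨hB, hBn⟩ | rfl | rfl, hxB⟩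
        · exact absurd (Or.inl (L.eq_of_mem hx hB hmemu hxB hxu)) hBn
        · exact absurd (hxu.symm.trans hxB) hne
        · rfl
      by_cases hxu' : x = u'
      · refine ⟨{u'}, ⟨Or.inr (Or.inl rfl), hxu'⟩, ?_⟩
        rintro B ⟨⟨hB, hBn⟩ | rfl | rfl, hxB⟩
        · exact absurd (Or.inr (L.eq_of_mem hx hB hmem hxB (Or.inl hxu'))) hBn
        · rfl
        · rcases hxB with h | h
          · exact absurd h hxu
          · exact absurd (hxu'.symm.trans h) hud'
      by_cases hxd : x = d
      · refine ⟨{u, d}, ⟨Or.inr (Or.inr rfl), Or.inr hxd⟩, ?_⟩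
        rintro B ⟨⟨hB, hBn⟩ | rfl | rfl, hxB⟩
        · exact absurd (Or.inr (L.eq_of_mem hx hB hmem hxB (Or.inr hxd))) hBn
        · exact absurd hxB hxu'
        · rfl
      obtain ⟨B, ⟨hB, hxB⟩, huniq⟩ := L.isTiling.partition x hx
      refine ⟨B, ⟨Or.inl ⟨hB, ?_⟩, hxB⟩, ?_⟩
      · rintro (rfl | rfl)
        · exact hxu hxB
        · rcases hxB with h | h
          · exact hxu' h
          · exact hxd h
      · rintro B' ⟨⟨hB', -⟩ | rfl | rfl, hxB'⟩
        · exact huniq B' ⟨hB', hxB'⟩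
        · exact absurd hxB' hxu'
        · rcases hxB' with h | h
          · exact absurd h hxu
          · exact absurd h hxd
  have hbij : BijOn (update L.triangle t u') univ {x | {x} ∈ S} := by
    refine ⟨fun s _ => ?_, fun s _ s' _ h => ?_, fun x hx => ?_⟩
    · change {update L.triangle t u' s} ∈ S
      rw [hsing]
      by_cases hst : s = t
      · right; rw [hst, update_self]
      · left
        rw [update_of_ne hst]
        exact ⟨L.singleton_mem s, fun h => hst (L.bijOn.injOn (mem_univ _) (mem_univ _) h)⟩
    · by_cases hst : s = t <;> by_cases hst' : s' = t
      · rw [hst, hst']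
      · rw [hst, update_self, update_of_ne hst'] at h
        exact absurd (h ▸ L.singleton_mem s') hnot
      · rw [hst', update_self, update_of_ne hst] at h
        exact absurd (h ▸ L.singleton_mem s) hnot
      · rw [update_of_ne hst, update_of_ne hst'] at h
        exact L.bijOn.injOn (mem_univ _) (mem_univ _) h
    · rcases (hsing x).1 hx with ⟨hx, hxu⟩ | rfl
      · obtain ⟨s, -, rfl⟩ := L.bijOn.surjOn hx
        refine ⟨s, mem_univ s, update_of_ne ?_ _ _⟩
        rintro rfl
        exact hxu rfl
      · exact ⟨t, mem_univ t, update_self _ _ _⟩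
  refine ⟨⟨S, htiling, _, hbij⟩, ⟨u, d, u', hu, hd, hu', hne, hadj, hadj', ⟨_, ?_, rfl⟩, t, rfl,
    update_self _ _ _, fun j hj => (update_of_ne hj _ _).symm⟩, rfl, Or.inr (Or.inr rfl)⟩
  exact (sdiff_union_of_subset (by rintro B (rfl | rfl) <;> assumption)).symm

/-- All upward tiles can be moved to the bottom row. -/
theorem exists_reachable_row_eq_zero :
    ∃ L', (trapezoidFlipGraph k).Reachable L L' ∧ ∀ t, (L'.triangle t).row = 0 := by
  induction hn : ∑ t, (L.triangle t).row using Nat.strong_induction_on generalizing L with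
  | _ n ih =>
  subst hn
  by_cases h : ∀ t, (L.triangle t).row = 0
  · exact ⟨L, SimpleGraph.Reachable.refl _, h⟩
  · push Not at h
    obtain ⟨t, ht⟩ := h
    obtain ⟨⟨i, j, hij⟩, hs⟩ := L.isUpward_of_singleton_mem (L.singleton_mem t)
    rw [hij] at hs
    have hj : j ≠ 0 := by rwa [hij] at ht
    obtain ⟨j, rfl⟩ := Nat.exists_eq_succ_of_ne_zero hj
    rw [inSize_up_iff] at hs
    -- The tile rests on `down i j`, whose lozenge partner cannot be this tile and hence lies one
    -- row lower. The flip thus decreases the sum of the rows.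
    have hds : (down i j).InSize k := inSize_down_iff.2 (by omega)
    obtain ⟨u', hu', hus', hadj', hmem⟩ := L.exists_partner ⟨i, j, rfl⟩ hds
    obtain ⟨L', hL', htri, -⟩ := L.exists_flip t hu' hus' ⟨i, j, rfl⟩ hds
      (by rw [hij]; exact adjacent_up_down_iff.2 (by omega)) hadj' hmem
    have hne : u' ≠ L.triangle t := by
      intro h
      obtain ⟨hu, hus⟩ := L.isUpward_of_singleton_mem (L.singleton_mem t)
      have h1 := L.eq_of_mem hus (L.singleton_mem t) hmem rfl (Or.inl h.symm)
      have h2 : down i j ∈ ({L.triangle t} : Set UnitTriangle) := by rw [h1]; simp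
      exact hu.ne_of_isDownward ⟨i, j, rfl⟩ h2.symm
    have hrow : u'.row < (L.triangle t).row := by
      obtain ⟨a, b, rfl⟩ := hu'
      rw [adjacent_up_down_iff] at hadj'
      rw [hij] at hne ⊢
      simp only [ne_eq, up.injEq, not_and, row] at hne ⊢
      omega
    have hlt : ∑ s, (L'.triangle s).row < ∑ s, (L.triangle s).row := by
      refine Finset.sum_lt_sum (fun s _ => ?_) ⟨t, Finset.mem_univ t, ?_⟩
      · rw [htri]
        by_cases hst : s = t
        · rw [hst, update_self]; exact hrow.le
        · rw [update_of_ne hst]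
      · rw [htri, update_self]; exact hrow
    obtain ⟨L'', hreach, h0⟩ := ih _ hlt L' rfl
    exact ⟨L'', hL'.reachable.trans hreach, h0⟩

end LabeledLozengeTiling

/-- The lozenge tiling whose upward tiles form the bottom row. -/
def groundTiles (k : ℕ) : Set (Set UnitTriangle) :=
  {B | (∃ i, i < k ∧ B = {up i 0}) ∨ ∃ i j, i + j + 2 ≤ k ∧ B = {up i (j + 1), down i j}}

theorem singleton_mem_groundTiles_iff {k : ℕ} {t : UnitTriangle} :
    {t} ∈ groundTiles k ↔ ∃ i, i < k ∧ t = up i 0 := by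
  constructor
  · rintro (⟨i, hi, h⟩ | ⟨i, j, -, h⟩)
    · exact ⟨i, hi, singleton_eq_singleton_iff.1 h⟩
    · have h1 : up i (j + 1) ∈ ({t} : Set UnitTriangle) := by rw [h]; simp
      have h2 : down i j ∈ ({t} : Set UnitTriangle) := by rw [h]; simp
      have := h1.trans h2.symm
      simp at this
  · rintro ⟨i, hi, rfl⟩
    exact Or.inl ⟨i, hi, rfl⟩

theorem exists_mem_groundTiles {k : ℕ} {t : UnitTriangle} (ht : t.InSize k) :
    ∃ B ∈ groundTiles k, t ∈ B := by
  rcases t with ⟨i, _ | j⟩ | ⟨i, j⟩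
  · rw [inSize_up_iff] at ht
    exact ⟨_, Or.inl ⟨i, by omega, rfl⟩, rfl⟩
  · rw [inSize_up_iff] at ht
    exact ⟨_, Or.inr ⟨i, j, by omega, rfl⟩, Or.inl rfl⟩
  · rw [inSize_down_iff] at ht
    exact ⟨_, Or.inr ⟨i, j, by omega, rfl⟩, Or.inr rfl⟩

theorem isLozengeTiling_groundTiles (k : ℕ) : IsLozengeTiling k (groundTiles k) := by
  constructor
  · rintro B (⟨i, hi, rfl⟩ | ⟨i, j, hij, rfl⟩)
    · exact Or.inr ⟨_, ⟨i, 0, rfl⟩, inSize_up_iff.2 (by omega), rfl⟩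
    · exact Or.inl ⟨_, _, ⟨i, j + 1, rfl⟩, ⟨i, j, rfl⟩, inSize_up_iff.2 (by omega),
        inSize_down_iff.2 hij, adjacent_up_down_iff.2 (by omega), rfl⟩
  · intro t ht
    obtain ⟨B, hB, htB⟩ := exists_mem_groundTiles ht
    refine ⟨B, ⟨hB, htB⟩, ?_⟩
    rintro B' ⟨hB', htB'⟩
    rcases hB with ⟨i, hi, rfl⟩ | ⟨i, j, hij, rfl⟩ <;>
      rcases hB' with ⟨i', hi', rfl⟩ | ⟨i', j', hij', rfl⟩
    all_goals simp only [mem_insert_iff, mem_singleton_iff] at htB htB'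
    · rw [← htB, ← htB']
    · rcases htB' with h | h <;> simp [htB] at h
    · rcases htB with h | h <;> simp [htB'] at h
    · rcases htB with rfl | rfl <;> simp at htB' <;> simp [htB']

/-- The labelings of the tiling `groundTiles k`. -/
def groundTiling {k : ℕ} (σ : Equiv.Perm (Fin k)) : LabeledLozengeTiling k where
  tiles := groundTiles k
  isTiling := isLozengeTiling_groundTiles k
  triangle t := up (σ t) 0
  bijOn := by
    refine ⟨fun t _ => singleton_mem_groundTiles_iff.2 ⟨_, (σ t).2, rfl⟩, fun t _ t' _ h => ?_,
      fun t ht => ?_⟩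
    · simp only [up.injEq, and_true] at h
      exact σ.injective (Fin.ext h)
    · obtain ⟨i, hi, rfl⟩ := singleton_mem_groundTiles_iff.1 ht
      exact ⟨σ.symm ⟨i, hi⟩, mem_univ _, by simp⟩

namespace LabeledLozengeTiling

variable {k : ℕ}

/-- The `k` upward tiles fill the bottom row. Going up row by row, the two neighbours of a downward
triangle in its own row are already used, so its partner is the upward triangle above it. -/
theorem eq_groundTiling (L : LabeledLozengeTiling k) (h : ∀ t, (L.triangle t).row = 0) :
    ∃ σ, L = groundTiling σ := by
  have hex : ∀ t, ∃ x : Fin k, L.triangle t = up x 0 := by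
    intro t
    obtain ⟨⟨i, j, hij⟩, hs⟩ := L.isUpward_of_singleton_mem (L.singleton_mem t)
    have ht := h t
    rw [hij] at hs ht
    rw [inSize_up_iff] at hs
    simp only [row] at ht
    subst ht
    exact ⟨⟨i, by omega⟩, hij⟩
  choose x hx using hex
  have hinj : Injective x := by
    intro t t' htt
    refine L.bijOn.injOn (mem_univ t) (mem_univ t') ?_
    rw [hx, hx, htt]
  have hbij : Bijective x := Finite.injective_iff_bijective.1 hinj
  refine ⟨Equiv.ofBijective x hbij, ?_⟩
  have h0 : ∀ i, i < k → {up i 0} ∈ L.tiles := by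
    intro i hi
    obtain ⟨t, ht⟩ := hbij.2 ⟨i, hi⟩
    have := L.singleton_mem t
    rwa [hx, ht] at this
  have h1 : ∀ j i, i + j + 2 ≤ k → {up i (j + 1), down i j} ∈ L.tiles := by
    intro j
    induction j with
    | zero =>
      intro i hi
      obtain ⟨u, ⟨a, b, rfl⟩, hus, hadj, hmem⟩ := L.exists_partner ⟨i, 0, rfl⟩
        (inSize_down_iff.2 hi)
      rw [inSize_up_iff] at hus
      rcases b with _ | b
      · have := L.eq_of_mem (inSize_up_iff.2 hus) (h0 a (by omega)) hmem rfl (Or.inl rfl)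
        have h2 : down i 0 ∈ ({up a 0} : Set UnitTriangle) := by rw [this]; simp
        simp at h2
      · rw [adjacent_up_down_iff] at hadj
        obtain ⟨rfl, rfl⟩ : a = i ∧ b = 0 := by omega
        exact hmem
    | succ j ih =>
      intro i hi
      obtain ⟨u, ⟨a, b, rfl⟩, hus, hadj, hmem⟩ := L.exists_partner ⟨i, j + 1, rfl⟩
        (inSize_down_iff.2 hi)
      have hus' := hus
      rw [inSize_up_iff] at hus
      rw [adjacent_up_down_iff] at hadj
      by_cases hb : b = j + 1
      · subst hb
        have := L.eq_of_mem hus' (ih a (by omega)) hmem (Or.inl rfl) (Or.inl rfl)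
        have h2 : down i (j + 1) ∈ ({up a (j + 1), down a j} : Set UnitTriangle) := by
          rw [this]; simp
        simp at h2
      · obtain ⟨rfl, rfl⟩ : a = i ∧ b = j + 1 + 1 := by omega
        exact hmem
  have hsub : groundTiles k ⊆ L.tiles := by
    rintro B (⟨i, hi, rfl⟩ | ⟨i, j, hij, rfl⟩)
    · exact h0 i hi
    · exact h1 j i hij
  apply LabeledLozengeTiling.ext
  · refine subset_antisymm (fun B hB => ?_) hsub
    obtain ⟨t, ht, hts⟩ : ∃ t ∈ B, t.InSize k := by
      rcases L.isTiling.isTile B hB with ⟨u, d, -, -, hus, -, -, rfl⟩ | ⟨u, -, hus, rfl⟩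
      · exact ⟨u, Or.inl rfl, hus⟩
      · exact ⟨u, rfl, hus⟩
    obtain ⟨B', hB', ht'⟩ := exists_mem_groundTiles hts
    rw [L.eq_of_mem hts hB (hsub hB') ht ht']
    exact hB'
  · funext t
    exact hx t

end LabeledLozengeTiling

/-- The labels of two adjacent triangles in the bottom row can be interchanged. -/
theorem reachable_swap {n : ℕ} (i : Fin n) (σ : Equiv.Perm (Fin (n + 1))) :
    (trapezoidFlipGraph (n + 1)).Reachable (groundTiling σ)
      (groundTiling (Equiv.swap i.castSucc i.succ * σ)) := by
  set s := σ.symm i.castSucc with hs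
  set t := σ.symm i.succ with ht
  have hst : s ≠ t := fun h => (Fin.castSucc_lt_succ (i := i)).ne (σ.symm.injective h)
  have hi : (i : ℕ) + 0 + 2 ≤ n + 1 := by omega
  have hd : (down i 0).IsDownward := ⟨i, 0, rfl⟩
  have hds : (down i 0).InSize (n + 1) := inSize_down_iff.2 hi
  have hA : (up i 0).InSize (n + 1) := inSize_up_iff.2 (by omega)
  have hB : (up (i + 1) 0).InSize (n + 1) := inSize_up_iff.2 (by omega)
  have hC : (up i 1).InSize (n + 1) := inSize_up_iff.2 (by omega)
  have hAd : (up i 0).Adjacent (down i 0) := adjacent_up_down_iff.2 (by omega)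
  have hBd : (up (i + 1) 0).Adjacent (down i 0) := adjacent_up_down_iff.2 (by omega)
  have hCd : (up i 1).Adjacent (down i 0) := adjacent_up_down_iff.2 (by omega)
  have hs0 : (groundTiling σ).triangle s = up i 0 := by simp [groundTiling, hs]
  have ht0 : (groundTiling σ).triangle t = up (i + 1) 0 := by simp [groundTiling, ht]
  -- Three flips rotate two tiles around `down i 0`: `s` moves up, `t` takes the place that `s`
  -- left, and `s` comes down into the former place of `t`.
  obtain ⟨L₁, hL₁, htri₁, hmem₁⟩ := (groundTiling σ).exists_flip s (u' := up i 1) ⟨_, _, rfl⟩ hC hd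
    hds (by rw [hs0]; exact hAd) hCd (Or.inr ⟨i, 0, hi, rfl⟩)
  rw [hs0] at hmem₁
  have ht1 : L₁.triangle t = up (i + 1) 0 := by rw [htri₁, update_of_ne hst.symm, ht0]
  obtain ⟨L₂, hL₂, htri₂, hmem₂⟩ := L₁.exists_flip t ⟨_, _, rfl⟩ hA hd hds
    (by rw [ht1]; exact hBd) hAd hmem₁
  rw [ht1] at hmem₂
  have hs2 : L₂.triangle s = up i 1 := by rw [htri₂, update_of_ne hst, htri₁, update_self]
  obtain ⟨L₃, hL₃, htri₃, -⟩ := L₂.exists_flip s ⟨_, _, rfl⟩ hB hd hds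
    (by rw [hs2]; exact hCd) hBd hmem₂
  have htri : ∀ r, L₃.triangle r = up ((Equiv.swap i.castSucc i.succ * σ) r) 0 := by
    intro r
    rw [htri₃, Equiv.Perm.mul_apply]
    by_cases hrs : r = s
    · rw [hrs, update_self, hs, Equiv.apply_symm_apply, Equiv.swap_apply_left, Fin.val_succ]
    · rw [update_of_ne hrs, htri₂]
      by_cases hrt : r = t
      · rw [hrt, update_self, ht, Equiv.apply_symm_apply, Equiv.swap_apply_right, Fin.val_castSucc]
      · rw [update_of_ne hrt, htri₁, update_of_ne hrs, Equiv.swap_apply_of_ne_of_ne]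
        · rfl
        · intro h; exact hrs (by rw [hs, ← h, Equiv.symm_apply_apply])
        · intro h; exact hrt (by rw [ht, ← h, Equiv.symm_apply_apply])
  obtain ⟨ρ, hρ⟩ := L₃.eq_groundTiling fun r => by rw [htri]; rfl
  have heq : L₃ = groundTiling (Equiv.swap i.castSucc i.succ * σ) := by
    apply LabeledLozengeTiling.ext
    · rw [hρ]; rfl
    · funext r; exact htri r
  rw [← heq]
  exact hL₁.reachable.trans (hL₂.reachable.trans hL₃.reachable)

/-- The graph of labeled lozenge tilings is connected. -/
theorem trapezoidFlipGraph_connected (k : ℕ) : (trapezoidFlipGraph k).Connected := by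
  have hperm : ∀ π σ : Equiv.Perm (Fin k),
      (trapezoidFlipGraph k).Reachable (groundTiling σ) (groundTiling (π * σ)) := by
    rcases k with _ | n
    · intro π σ
      rw [Subsingleton.elim (π * σ) σ]
    · intro π
      -- Adjacent transpositions generate the permutations already as a monoid, so no step for
      -- inverses is needed.
      have hπ : π ∈ Submonoid.closure
          (range fun i : Fin n => Equiv.swap i.castSucc i.succ) := by
        rw [Equiv.Perm.mclosure_swap_castSucc_succ]; trivial
      induction hπ using Submonoid.closure_induction with
      | mem x hx =>
        obtain ⟨i, rfl⟩ := hx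
        exact reachable_swap i
      | one => intro σ; rw [one_mul]
      | mul x y _ _ hx hy =>
        intro σ
        rw [mul_assoc]
        exact (hy σ).trans (hx _)
  have hall : ∀ L, (trapezoidFlipGraph k).Reachable L (groundTiling 1) := by
    intro L
    obtain ⟨L', hreach, h0⟩ := L.exists_reachable_row_eq_zero
    obtain ⟨σ, rfl⟩ := L'.eq_groundTiling h0
    refine hreach.trans ?_
    have := hperm σ⁻¹ σ
    rwa [inv_mul_cancel] at this
  have : Nonempty (LabeledLozengeTiling k) := ⟨groundTiling 1⟩
  exact ⟨fun L L' => (hall L).trans (hall L').symm⟩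

end LozengeTilings

theorem mainTheorem1 (k : ℕ) (hk : 1 ≤ k) :
    (trapezoidFlipGraph k).Connected ∧
      (bistellarFlipGraph (triangleTimesSimplex k)).Connected :=
  ⟨trapezoidFlipGraph_connected k, bistellarFlipGraph_connected k hk⟩
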